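/- Let $G$ be a locally compact group with left Haar measure $dg$, let $\|\cdot\|_q$ denote the $L^q$-norm with respect to $dg$ $(1\le q\le\infty)$, and let $\Delta_G\colon G\to\mathbb{R}_{>0}$ be the modular function, i.e. the continuous homomorphism with $\int_G\phi(g^{-1})\,dg=\int_G\phi(g)\Delta_G(g)^{-1}\,dg$. For measurable $\phi_1,\phi_2\colon G\to\mathbb{C}$ put $(\phi_1*\phi_2)(g')=\int_G\phi_1(g)\phi_2(g^{-1}g')\,dg$. For $1\le p_1,p_2\le\infty$ with $1/p_1+1/p_2\ge 1$, define $1\le p\le\infty$ by $1/p_1+1/p_2=1+1/p$, let $p_1'$ be the Hölder conjugate of $p_1$ (so $1/p_1+1/p_1'=1$), and define the optimal Young constant $$Y(p_1,p_2;G)=\sup\bigl\{\|\phi_1*(\phi_2\Delta_G^{1/p_1'})\|_p \;:\; \phi_1,\phi_2\colon G\to\mathbb{C}\text{ measurable},\ \|\phi_1\|_{p_1}=\|\phi_2\|_{p_2}=1\bigr\}.$$ **Theorem.** Let $1\le p_1,p_2\le\infty$ satisfy $1/p_1+1/p_2\ge 1$. Then for every locally compact group $G$ and every closed subgroup $H\subset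 G$, $$Y(p_1,p_2;G)\le Y(p_1,p_2;H).$$ -/

import Mathlib

open scoped ENNReal NNReal

noncomputable section

/-- The modular function `Δ : G → ℝ_{>0}` of a locally compact group, normalised by
`∫ φ (g⁻¹) dg = ∫ φ (g) / Δ (g) dg` for a left Haar measure `dg`; equivalently
`μ (E g) = Δ (g) μ (E)` for a left Haar measure `μ`.
Mathlib's `modularCharacter g` is the ratio `μ (E g⁻¹) / μ (E)`, hence the inverse of `Δ g`. -/
def modularFunction {G : Type*} [Group G] [TopologicalSpace G] [IsTopologicalGroup G]
    [LocallyCompactSpace G] (g : G) : ℝ :=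
  ((MeasureTheory.Measure.modularCharacter g : ℝ≥0) : ℝ)⁻¹

/-- The normalisation of the modular function: `μ (E g) = Δ (g) μ (E)`. -/
theorem haar_image_mul_right {G : Type*} [Group G] [TopologicalSpace G] [IsTopologicalGroup G]
    [LocallyCompactSpace G] [MeasurableSpace G] [BorelSpace G] (g : G) (E : Set G) :
    (MeasureTheory.Measure.haar : MeasureTheory.Measure G) ((fun x => x * g) '' E)
      = ENNReal.ofReal (modularFunction g)
        * (MeasureTheory.Measure.haar : MeasureTheory.Measure G) E := by
  set μ : MeasureTheory.Measure G := MeasureTheory.Measure.haar with hμ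
  have hreg : (MeasureTheory.Measure.map (fun x => x * g) μ).Regular :=
    MeasureTheory.Measure.Regular.map (Homeomorph.mulRight g)
  have h1 : MeasureTheory.Measure.map (fun x => x * g) μ
      = MeasureTheory.Measure.modularCharacterFun g • μ := by
    rw [MeasureTheory.Measure.modularCharacterFun_eq_haarScalarFactor μ g]
    exact MeasureTheory.Measure.isMulLeftInvariant_eq_smul_of_regular _ μ
  have h2 : MeasureTheory.Measure.map (fun x => x * g) μ ((fun x => x * g) '' E) = μ E := by
    have := (MeasurableEquiv.mulRight g).map_apply (μ := μ) ((fun x => x * g) '' E)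
    rw [MeasurableEquiv.coe_mulRight] at this
    rw [this, Set.preimage_image_eq _ (mul_left_injective g)]
  rw [h1] at h2
  have hpos : MeasureTheory.Measure.modularCharacterFun g ≠ 0 :=
    (MeasureTheory.Measure.modularCharacterFun_pos g).ne'
  have hc : ENNReal.ofReal (modularFunction g)
      = ((MeasureTheory.Measure.modularCharacterFun g : ℝ≥0) : ℝ≥0∞)⁻¹ := by
    rw [← ENNReal.coe_inv hpos, modularFunction, ← NNReal.coe_inv, ENNReal.ofReal_coe_nnreal]
    rfl
  rw [hc, ← h2, MeasureTheory.Measure.smul_apply, ENNReal.smul_def, smul_eq_mul, ← mul_assoc,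
    ENNReal.inv_mul_cancel (by simpa using hpos) ENNReal.coe_ne_top, one_mul]

/-- The convolution `(φ₁ * φ₂) (g') = ∫ φ₁ (g) φ₂ (g⁻¹ g') dg` of complex functions with respect to
a left Haar measure. -/
def haarConvolution {G : Type*} [Group G] [TopologicalSpace G] [IsTopologicalGroup G]
    [LocallyCompactSpace G] [MeasurableSpace G] [BorelSpace G] (φ₁ φ₂ : G → ℂ) (g' : G) : ℂ :=
  ∫ g, φ₁ g * φ₂ (g⁻¹ * g') ∂(MeasureTheory.Measure.haar : MeasureTheory.Measure G)

/-- The exponent `p` with `1 / p₁ + 1 / p₂ = 1 + 1 / p`, for `1 / p₁ + 1 / p₂ ≥ 1`. -/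
def youngExponent (p₁ p₂ : ℝ≥0∞) : ℝ≥0∞ := (p₁⁻¹ + p₂⁻¹ - 1)⁻¹

/-- The optimal Young constant
`Y (p₁, p₂; G) = sup {‖φ₁ * (φ₂ Δ^(1 / p₁'))‖_p | ‖φ₁‖_{p₁} = ‖φ₂‖_{p₂} = 1}`, as an element of
`[0, ∞]`. The supremum runs over measurable functions `φ₁ φ₂ : G → ℂ`, and `p₁'` is the Hölder
conjugate of `p₁`. -/
def youngConst (p₁ p₂ : ℝ≥0∞) (G : Type*) [Group G] [TopologicalSpace G] [IsTopologicalGroup G]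
    [LocallyCompactSpace G] [MeasurableSpace G] [BorelSpace G] : ℝ≥0∞ :=
  sSup {c : ℝ≥0∞ | ∃ φ₁ φ₂ : G → ℂ, Measurable φ₁ ∧ Measurable φ₂ ∧
    MeasureTheory.eLpNorm φ₁ p₁ (MeasureTheory.Measure.haar : MeasureTheory.Measure G) = 1 ∧
    MeasureTheory.eLpNorm φ₂ p₂ (MeasureTheory.Measure.haar : MeasureTheory.Measure G) = 1 ∧
    c = MeasureTheory.eLpNorm
      (haarConvolution φ₁
        fun g => φ₂ g * ((modularFunction g ^ ((ENNReal.conjExponent p₁)⁻¹).toReal : ℝ) : ℂ))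
      (youngExponent p₁ p₂) (MeasureTheory.Measure.haar : MeasureTheory.Measure G)}

end

section

open scoped ENNReal NNReal Pointwise Topology
open MeasureTheory Measure Filter

section Modular

variable {G : Type*} [Group G] [TopologicalSpace G] [IsTopologicalGroup G]
  [LocallyCompactSpace G] [MeasurableSpace G] [BorelSpace G]

theorem map_mul_right_haar (g : G) :
    map (· * g) (haar : Measure G) = modularCharacter g • (haar : Measure G) := by
  have : (map (· * g) (haar : Measure G)).Regular := Regular.map (Homeomorph.mulRight g)
  change _ = modularCharacterFun g • _
  rw [modularCharacterFun_eq_haarScalarFactor haar g]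
  exact isMulLeftInvariant_eq_smul_of_regular _ _

theorem lintegral_haar_mul_right (f : G → ℝ≥0∞) (g : G) :
    ∫⁻ x, f (x * g) ∂haar = modularCharacter g * ∫⁻ x, f x ∂haar := by
  have h := lintegral_map_equiv (μ := (haar : Measure G)) f (MeasurableEquiv.mulRight g)
  simp only [MeasurableEquiv.coe_mulRight] at h
  rw [← h, map_mul_right_haar, lintegral_smul_measure, ENNReal.smul_def, smul_eq_mul]

theorem modularCharacter_ne_zero {G : Type*} [Group G] [TopologicalSpace G] [IsTopologicalGroup G]
    [LocallyCompactSpace G] (g : G) : modularCharacter g ≠ 0 :=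
  (modularCharacterFun_pos g).ne'

theorem continuous_modularCharacter {G : Type*} [Group G] [TopologicalSpace G]
    [IsTopologicalGroup G] [LocallyCompactSpace G] :
    Continuous (modularCharacter : G → ℝ≥0) := by
  borelize G
  obtain ⟨f, hfc, hf0, hf1⟩ := exists_continuous_nonneg_pos (1 : G)
  have hpos : 0 < ∫ x, f x ∂(haar : Measure G) :=
    f.2.integral_pos_of_hasCompactSupport_nonneg_nonzero hfc hf0 hf1
  have hc : Continuous fun g : G => ∫ x, f (x⁻¹ * g) ∂(haar : Measure G).inv :=
    continuous_integral_apply_inv_mul f.2 hfc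
  have key : ∀ g : G, ∫ x, f (x⁻¹ * g) ∂(haar : Measure G).inv
      = modularCharacter g * ∫ x, f x ∂(haar : Measure G) := by
    intro g
    have h1 := integral_map_equiv (μ := (haar : Measure G)) (MeasurableEquiv.inv G)
      (fun x => f (x⁻¹ * g))
    have h2 := integral_map_equiv (μ := (haar : Measure G)) (MeasurableEquiv.mulRight g) f
    simp only [MeasurableEquiv.coe_mulRight] at h2
    rw [map_mul_right_haar, integral_smul_nnreal_measure] at h2
    change ∫ x, f (x⁻¹ * g) ∂(haar : Measure G).inv = _ at h1
    rw [h1]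
    simp only [MeasurableEquiv.inv_apply, inv_inv]
    rw [← h2]; rfl
  rw [NNReal.isEmbedding_coe.continuous_iff]
  have : (fun g : G => ((modularCharacter g : ℝ≥0) : ℝ))
      = fun g => (∫ x, f (x⁻¹ * g) ∂(haar : Measure G).inv) / ∫ x, f x ∂(haar : Measure G) := by
    funext g; rw [key, mul_div_cancel_right₀ _ hpos.ne']
  change Continuous fun g : G => ((modularCharacter g : ℝ≥0) : ℝ)
  rw [this]
  exact hc.div_const _

theorem measurable_modularCharacter : Measurable fun g : G => (modularCharacter g : ℝ≥0∞) :=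
  (ENNReal.continuous_coe.comp continuous_modularCharacter).measurable

variable (G) in
/-- The image of a left Haar measure under inversion, weighted by the modular function. -/
noncomputable def weightedInvHaar : Measure G :=
  (haar : Measure G).inv.withDensity fun g => (modularCharacter g⁻¹ : ℝ≥0∞)

theorem lintegral_weightedInvHaar {f : G → ℝ≥0∞} (hf : Measurable f) :
    ∫⁻ x, f x ∂(weightedInvHaar G) = ∫⁻ x, f x⁻¹ * modularCharacter x ∂haar := by
  have h1 := lintegral_map_equiv (μ := (haar : Measure G))
    (fun x => (modularCharacter x⁻¹ : ℝ≥0∞) * f x) (MeasurableEquiv.inv G)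
  change ∫⁻ x, (modularCharacter x⁻¹ : ℝ≥0∞) * f x ∂(haar : Measure G).inv = _ at h1
  have h2 := lintegral_withDensity_eq_lintegral_mul (haar : Measure G).inv
    (measurable_modularCharacter.comp (measurable_inv (G := G))) hf
  simp only [Pi.mul_apply, Function.comp_def] at h2
  rw [weightedInvHaar, h2, h1]
  simp [mul_comm]

instance : IsLocallyFiniteMeasure (weightedInvHaar G) :=
  IsLocallyFiniteMeasure.withDensity_coe (continuous_modularCharacter.comp continuous_inv)

instance : IsOpenPosMeasure (weightedInvHaar G) := by
  refine AbsolutelyContinuous.isOpenPosMeasure (μ := (haar : Measure G).inv) ?_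
  refine withDensity_absolutelyContinuous'
    (measurable_modularCharacter.comp measurable_inv).aemeasurable (ae_of_all _ fun x => ?_)
  exact ENNReal.coe_ne_zero.2 (modularCharacter_ne_zero _)

instance : IsMulLeftInvariant (weightedInvHaar G) := by
  rw [← forall_measure_preimage_mul_iff]
  intro g A hA
  have hA' : MeasurableSet ((fun h => g * h) ⁻¹' A) := measurable_const_mul g hA
  rw [← lintegral_indicator_one hA, ← lintegral_indicator_one hA',
    lintegral_weightedInvHaar (measurable_one.indicator hA),
    lintegral_weightedInvHaar (measurable_one.indicator hA')]
  have h := lintegral_haar_mul_right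
    (fun x => (A.indicator 1 x⁻¹ : ℝ≥0∞) * modularCharacter (x * g)) g⁻¹
  have hm : Measurable fun x : G => (A.indicator 1 x⁻¹ : ℝ≥0∞) * modularCharacter x :=
    ((measurable_one.indicator hA).comp measurable_inv).mul measurable_modularCharacter
  simp only [map_mul, ENNReal.coe_mul, ← mul_assoc] at h
  rw [lintegral_mul_const _ hm, mul_comm, mul_assoc, ← ENNReal.coe_mul, ← map_mul,
    mul_inv_cancel, map_one, ENNReal.coe_one, mul_one] at h
  rw [← h]
  refine lintegral_congr fun x => ?_
  have : (A.indicator 1 (x * g⁻¹)⁻¹ : ℝ≥0∞) = ((fun h => g * h) ⁻¹' A).indicator 1 x⁻¹ := by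
    have hx : (x * g⁻¹)⁻¹ = g * x⁻¹ := by group
    rw [hx]; rfl
  rw [this, mul_assoc, mul_assoc, ← ENNReal.coe_mul, ← ENNReal.coe_mul, ← map_mul, ← map_mul]
  simp

instance : IsHaarMeasure (weightedInvHaar G) where

theorem weightedInvHaar_apply_of_isOpen {U : Set G} (hU : IsOpen U) :
    weightedInvHaar G U = (haar : Measure G) U := by
  have key : ∀ {U : Set G}, IsOpen U →
      weightedInvHaar G U = haarScalarFactor (weightedInvHaar G) haar * (haar : Measure G) U :=
    fun hU => measure_isHaarMeasure_eq_smul_of_isOpen (weightedInvHaar G) haar hU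
  set κ := haarScalarFactor (weightedInvHaar G) haar
  suffices hκ : κ = 1 by rw [key hU, hκ, ENNReal.coe_one, one_mul]
  have hbound : ∀ c : ℝ≥0, 1 < c → κ ≤ c ∧ 1 ≤ c * κ := by
    intro c hc
    obtain ⟨N, h1N, hNo, hNfin⟩ := (haar : Measure G).exists_isOpen_measure_lt_top 1
    set V : Set G := N ∩ {x | modularCharacter x < c}
    have hV : IsOpen V := hNo.inter (isOpen_Iio.preimage continuous_modularCharacter)
    set U : Set G := V ∩ V⁻¹
    have hU : IsOpen U := hV.inter hV.inv
    have h1U : (1 : G) ∈ U := by simp [U, V, h1N, hc]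
    have hUfin : (haar : Measure G) U ≠ ∞ :=
      ((measure_mono (Set.inter_subset_left.trans Set.inter_subset_left)).trans_lt hNfin).ne
    have hUpos : (haar : Measure G) U ≠ 0 := (hU.measure_pos _ ⟨1, h1U⟩).ne'
    have hsymm : ∀ x, x⁻¹ ∈ U ↔ x ∈ U := by simp [U, and_comm]
    have hval : weightedInvHaar G U = ∫⁻ x in U, modularCharacter x ∂haar := by
      rw [← lintegral_indicator_one hU.measurableSet,
        lintegral_weightedInvHaar (measurable_one.indicator hU.measurableSet),
        ← lintegral_indicator hU.measurableSet]
      refine lintegral_congr fun x => ?_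
      by_cases hx : x ∈ U <;> simp [Set.indicator, hsymm, hx]
    rw [key hU] at hval
    have hlt : ∀ x ∈ U, modularCharacter x ≤ c ∧ 1 ≤ c * modularCharacter x := by
      intro x hx
      refine ⟨hx.1.2.le, ?_⟩
      have h2 : modularCharacter x⁻¹ ≤ c := ((hsymm x).2 hx).1.2.le
      calc (1 : ℝ≥0) = modularCharacter x⁻¹ * modularCharacter x := by
              rw [← map_mul, inv_mul_cancel, map_one]
        _ ≤ c * modularCharacter x := by gcongr
    constructor
    · have : (κ : ℝ≥0∞) * (haar : Measure G) U ≤ c * (haar : Measure G) U := by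
        rw [hval, ← setLIntegral_const]
        exact setLIntegral_mono' hU.measurableSet fun x hx => ENNReal.coe_le_coe.2 (hlt x hx).1
      exact_mod_cast (ENNReal.mul_le_mul_iff_left hUpos hUfin).1 this
    · have : 1 * (haar : Measure G) U ≤ (c * κ : ℝ≥0∞) * (haar : Measure G) U := by
        rw [mul_assoc, hval, ← setLIntegral_const, ← lintegral_const_mul _ measurable_modularCharacter]
        exact setLIntegral_mono' hU.measurableSet fun x hx => by exact_mod_cast (hlt x hx).2
      exact_mod_cast (ENNReal.mul_le_mul_iff_left hUpos hUfin).1 this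
  refine le_antisymm (le_of_forall_gt_imp_ge_of_dense fun c hc => (hbound c hc).1) ?_
  by_contra! hlt
  obtain ⟨c, hc1, hc2⟩ : ∃ c : ℝ≥0, 1 < c ∧ c * κ < 1 := by
    rcases eq_or_ne κ 0 with h0 | h0
    · exact ⟨2, by norm_num, by simp [h0]⟩
    · obtain ⟨c, hc1, hc2⟩ := exists_between (one_lt_inv_iff₀.2 ⟨pos_iff_ne_zero.2 h0, hlt⟩)
      exact ⟨c, hc1, by simpa [h0] using mul_lt_mul_of_pos_right hc2 (pos_iff_ne_zero.2 h0)⟩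
  exact absurd ((hbound c hc1).2) hc2.not_ge

theorem weightedInvHaar_le : weightedInvHaar G ≤ haar := by
  intro E
  rw [Set.measure_eq_iInf_isOpen E haar]
  simp only [le_iInf_iff]
  intro U hEU hU
  exact (measure_mono hEU).trans (weightedInvHaar_apply_of_isOpen hU).le

theorem lintegral_haar_inv {f : G → ℝ≥0∞} (hf : Measurable f) :
    ∫⁻ x, f x⁻¹ * modularCharacter x ∂haar = ∫⁻ x, f x ∂haar := by
  have key : ∀ {f : G → ℝ≥0∞}, Measurable f →
      ∫⁻ x, f x⁻¹ * modularCharacter x ∂haar ≤ ∫⁻ x, f x ∂haar := fun hf => by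
    rw [← lintegral_weightedInvHaar hf]
    exact lintegral_mono' weightedInvHaar_le le_rfl
  refine (key hf).antisymm ?_
  have h := key (f := fun x => f x⁻¹ * modularCharacter x)
    ((hf.comp measurable_inv).mul measurable_modularCharacter)
  simpa only [mul_assoc, ← ENNReal.coe_mul, inv_inv, ← map_mul, inv_mul_cancel, map_one,
    ENNReal.coe_one, mul_one] using h

end Modular

section ContinuousCompactSupport

variable {X Y : Type*} [TopologicalSpace X] [TopologicalSpace Y] [MeasurableSpace X]
  [MeasurableSpace Y] [OpensMeasurableSpace X] [OpensMeasurableSpace Y]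

theorem Continuous.aemeasurable_prod_of_isCompact [R1Space X] [LocallyCompactSpace X] [R1Space Y]
    [LocallyCompactSpace Y] {f : X × Y → ℝ≥0} (hf : Continuous f) {K : Set X} {L : Set Y}
    (hK : IsCompact K) (hL : IsCompact L) {μ : Measure X} {ν : Measure Y} [SFinite μ] [SFinite ν]
    (hμ : μ Kᶜ = 0) (hν : ν Lᶜ = 0) : AEMeasurable f (μ.prod ν) := by
  obtain ⟨χ, hχ1, -, hχc, -⟩ := exists_continuous_one_zero_of_isCompact (hK.prod hL)
    isClosed_empty (Set.disjoint_empty _)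
  have hcont : Continuous fun z => (χ z).toNNReal * f z :=
    (continuous_real_toNNReal.comp χ.2).mul hf
  have hsupp : HasCompactSupport fun z => (χ z).toNNReal * f z :=
    (hχc.comp_left (g := Real.toNNReal) Real.toNNReal_zero).mul_right
  refine ⟨_, (hsupp.stronglyMeasurable_of_prod hcont).measurable, ?_⟩
  have h1 : ∀ᵐ z ∂(μ.prod ν), z.1 ∈ K := Measure.quasiMeasurePreserving_fst.ae hμ
  have h2 : ∀ᵐ z ∂(μ.prod ν), z.2 ∈ L := Measure.quasiMeasurePreserving_snd.ae hν
  filter_upwards [h1, h2] with z hz1 hz2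
  have : χ z = 1 := hχ1 ⟨hz1, hz2⟩
  simp [this]

theorem lintegral_lintegral_swap_of_hasCompactSupport {f : X → Y → ℝ≥0}
    (hf : Continuous f.uncurry) (h'f : HasCompactSupport f.uncurry) (μ : Measure X) (ν : Measure Y)
    [IsFiniteMeasureOnCompacts μ] [IsFiniteMeasureOnCompacts ν] :
    ∫⁻ x, ∫⁻ y, f x y ∂ν ∂μ = ∫⁻ y, ∫⁻ x, f x y ∂μ ∂ν := by
  let U := Prod.fst '' (tsupport f.uncurry)
  have : Fact (μ U < ∞) := ⟨(IsCompact.image h'f continuous_fst).measure_lt_top⟩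
  let V := Prod.snd '' (tsupport f.uncurry)
  have : Fact (ν V < ∞) := ⟨(IsCompact.image h'f continuous_snd).measure_lt_top⟩
  have hU : ∀ x y, x ∉ U → f x y = 0 := fun x y => by
    contrapose!
    exact fun h => ⟨(x, y), subset_tsupport _ h, rfl⟩
  have hV : ∀ x y, y ∉ V → f x y = 0 := fun x y => by
    contrapose!
    exact fun h => ⟨(x, y), subset_tsupport _ h, rfl⟩
  have rU : ∀ g : X → ℝ≥0∞, (∀ x, x ∉ U → g x = 0) → ∫⁻ x in U, g x ∂μ = ∫⁻ x, g x ∂μ := by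
    intro g hg
    exact setLIntegral_eq_of_support_subset fun x hx => by_contra fun h => hx (hg x h)
  have rV : ∀ g : Y → ℝ≥0∞, (∀ y, y ∉ V → g y = 0) → ∫⁻ y in V, g y ∂ν = ∫⁻ y, g y ∂ν := by
    intro g hg
    exact setLIntegral_eq_of_support_subset fun x hx => by_contra fun h => hx (hg x h)
  calc ∫⁻ x, ∫⁻ y, f x y ∂ν ∂μ = ∫⁻ x in U, ∫⁻ y in V, f x y ∂ν ∂μ := by
        rw [rU _ fun x hx => by
          rw [rV _ fun y hy => by rw [hV x y hy, ENNReal.coe_zero]]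
          simp [hU x _ hx]]
        refine lintegral_congr fun x => (rV _ fun y hy => by rw [hV x y hy, ENNReal.coe_zero]).symm
    _ = ∫⁻ y in V, ∫⁻ x in U, f x y ∂μ ∂ν := by
        apply lintegral_lintegral_swap
        exact ((h'f.stronglyMeasurable_of_prod hf).measurable.coe_nnreal_ennreal).aemeasurable
    _ = ∫⁻ y, ∫⁻ x, f x y ∂μ ∂ν := by
        rw [rV _ fun y hy => by
          rw [rU _ fun x hx => by rw [hU x y hx, ENNReal.coe_zero]]
          simp [hV _ y hy]]
        refine lintegral_congr fun y => rU _ fun x hx => by rw [hU x y hx, ENNReal.coe_zero]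

end ContinuousCompactSupport

/-- A parametric integral of a nonnegative continuous function, compactly supported locally
uniformly in the parameter, is a finite continuous function. -/
theorem exists_continuous_eq_lintegral {X Y : Type*} [TopologicalSpace X] [TopologicalSpace Y]
    [MeasurableSpace Y] [OpensMeasurableSpace Y] [WeaklyLocallyCompactSpace X] {f : X → Y → ℝ≥0}
    (hf : Continuous f.uncurry)
    (hK : ∀ C : Set X, IsCompact C → ∃ K : Set Y, IsCompact K ∧ ∀ x ∈ C, ∀ y, f x y ≠ 0 → y ∈ K)
    (ν : Measure Y) [IsFiniteMeasureOnCompacts ν] :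
    ∃ v : X → ℝ≥0, Continuous v ∧ ∀ x, ∫⁻ y, f x y ∂ν = v x := by
  have hfx : ∀ x, Continuous (f x) := fun x => hf.comp (Continuous.prodMk_right x)
  have hsm : ∀ x, ∃ K : Set Y, IsCompact K ∧ ∀ y, f x y ≠ 0 → y ∈ K := fun x => by
    obtain ⟨K, hKc, h⟩ := hK {x} isCompact_singleton
    exact ⟨K, hKc, h x rfl⟩
  have hfin : ∀ x, ∫⁻ y, f x y ∂ν ≠ ∞ := by
    intro x
    obtain ⟨K, hKc, h⟩ := hsm x
    rw [← setLIntegral_eq_of_support_subset (s := K) fun y hy => h y fun h0 => hy (by simp [h0])]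
    exact (setLIntegral_lt_top_of_isCompact hKc.measure_lt_top.ne hKc (hfx x)).ne
  refine ⟨fun x => (∫⁻ y, f x y ∂ν).toNNReal, ?_, fun x => (ENNReal.coe_toNNReal (hfin x)).symm⟩
  rw [NNReal.isEmbedding_coe.continuous_iff]
  have heq : ((fun r : ℝ≥0 => (r : ℝ)) ∘ fun x => (∫⁻ y, f x y ∂ν).toNNReal)
      = fun x => ∫ y, (f x y : ℝ) ∂ν := by
    funext x
    have h1 := integral_eq_lintegral_of_nonneg_ae (μ := ν) (f := fun y => (f x y : ℝ))
      (ae_of_all _ fun y => (f x y).2)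
      (NNReal.continuous_coe.comp (hfx x)).measurable.aestronglyMeasurable
    simp only [ENNReal.ofReal_coe_nnreal] at h1
    exact h1.symm
  change Continuous ((fun r : ℝ≥0 => (r : ℝ)) ∘ fun x => (∫⁻ y, f x y ∂ν).toNNReal)
  rw [heq, continuous_iff_continuousAt]
  intro x
  obtain ⟨C, hC, hxC⟩ := exists_compact_mem_nhds x
  obtain ⟨K, hKc, h⟩ := hK C hC
  refine (continuousOn_integral_of_compact_support hKc (f := fun x y => (f x y : ℝ))
    (NNReal.continuous_coe.comp hf).continuousOn fun p y hp hy => ?_).continuousAt hxC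
  simpa using fun h0 => hy (h p hp y h0)

section Minkowski

variable {α β : Type*} [MeasurableSpace α] [MeasurableSpace β]

/-- Minkowski's integral inequality, with an upper bound `b` for the `L^p` norms. -/
theorem lintegral_lintegral_rpow_le {ν : Measure α} {μ : Measure β} [IsFiniteMeasure ν] [SFinite μ]
    {f : α → β → ℝ≥0∞} (hf : AEMeasurable f.uncurry (ν.prod μ))
    (hf' : ∀ y, AEMeasurable (fun x => f x y) ν) {b : α → ℝ≥0∞} (hb : AEMeasurable b ν) {p : ℝ}
    (hp : 1 ≤ p) (hle : ∀ᵐ x ∂ν, ∫⁻ y, f x y ^ p ∂μ ≤ b x ^ p) :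
    ∫⁻ y, (∫⁻ x, f x y ∂ν) ^ p ∂μ ≤ (∫⁻ x, b x ∂ν) ^ p := by
  have hp0 : 0 < p := one_pos.trans_le hp
  rcases eq_or_ne (∫⁻ x, b x ∂ν) ∞ with htop | hfin
  · simp [htop, hp0]
  have hbfin : ∀ᵐ x ∂ν, b x < ∞ := ae_lt_top' hb hfin
  have key : ∀ ε : ℝ≥0, 0 < ε →
      ∫⁻ y, (∫⁻ x, f x y ∂ν) ^ p ∂μ ≤ (∫⁻ x, b x ∂ν + ε * ν Set.univ) ^ p := by
    intro ε hε
    set c : α → ℝ≥0∞ := fun x => b x + ε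
    have hc : AEMeasurable c ν := hb.add_const _
    have hcint : ∫⁻ x, c x ∂ν = ∫⁻ x, b x ∂ν + ε * ν Set.univ := by
      rw [lintegral_add_right _ measurable_const, lintegral_const]
    have hc0 : ∀ x, c x ≠ 0 := fun x => by simp [c, hε.ne']
    have hcfin : ∀ᵐ x ∂ν, c x ≠ ∞ := hbfin.mono fun x hx => by simp [c, hx.ne]
    rw [← hcint]
    have hpt : ∀ y, (∫⁻ x, f x y ∂ν) ^ p
        ≤ (∫⁻ x, f x y ^ p * c x ^ (1 - p) ∂ν) * (∫⁻ x, c x ∂ν) ^ (p - 1) := by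
      intro y
      have h1 : ∫⁻ x, f x y ∂ν
          = ∫⁻ x, (f x y ^ p * c x ^ (1 - p)) ^ (1 / p) * c x ^ (1 - 1 / p) ∂ν := by
        refine lintegral_congr_ae (hcfin.mono fun x hx => ?_)
        change f x y = (f x y ^ p * c x ^ (1 - p)) ^ (1 / p) * c x ^ (1 - 1 / p)
        rw [ENNReal.mul_rpow_of_nonneg _ _ (by positivity), ← ENNReal.rpow_mul,
          ← ENNReal.rpow_mul, mul_one_div_cancel hp0.ne', ENNReal.rpow_one, mul_assoc,
          ← ENNReal.rpow_add _ _ (hc0 x) hx]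
        have : (1 - p) * (1 / p) + (1 - 1 / p) = 0 := by field_simp; ring
        rw [this, ENNReal.rpow_zero, mul_one]
      have h2 := ENNReal.lintegral_mul_norm_pow_le (μ := ν) (p := 1 / p) (q := 1 - 1 / p)
        (((hf' y).pow_const p).mul (hc.pow_const (1 - p))) hc (by positivity)
        (by rw [sub_nonneg, div_le_one hp0]; exact hp) (by ring)
      calc (∫⁻ x, f x y ∂ν) ^ p ≤ ((∫⁻ x, f x y ^ p * c x ^ (1 - p) ∂ν) ^ (1 / p)
            * (∫⁻ x, c x ∂ν) ^ (1 - 1 / p)) ^ p := by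
            rw [h1]; exact ENNReal.rpow_le_rpow h2 hp0.le
        _ = _ := by
            rw [ENNReal.mul_rpow_of_nonneg _ _ hp0.le, ← ENNReal.rpow_mul, ← ENNReal.rpow_mul,
              one_div_mul_cancel hp0.ne', ENNReal.rpow_one]
            congr 2; field_simp
    have hmeas : AEMeasurable (fun z : α × β => f z.1 z.2 ^ p * c z.1 ^ (1 - p)) (ν.prod μ) :=
      (hf.pow_const p).mul ((hc.comp_quasiMeasurePreserving
        Measure.quasiMeasurePreserving_fst).pow_const _)
    have hcpow : (∫⁻ x, c x ∂ν) ^ (p - 1) ≠ ∞ := by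
      refine ENNReal.rpow_ne_top_of_nonneg (by linarith) ?_
      rw [hcint]
      exact ENNReal.add_ne_top.2 ⟨hfin, ENNReal.mul_ne_top ENNReal.coe_ne_top (by simp)⟩
    calc ∫⁻ y, (∫⁻ x, f x y ∂ν) ^ p ∂μ
        ≤ ∫⁻ y, (∫⁻ x, f x y ^ p * c x ^ (1 - p) ∂ν) * (∫⁻ x, c x ∂ν) ^ (p - 1) ∂μ :=
          lintegral_mono hpt
      _ = (∫⁻ x, ∫⁻ y, f x y ^ p * c x ^ (1 - p) ∂μ ∂ν) * (∫⁻ x, c x ∂ν) ^ (p - 1) := by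
          rw [lintegral_mul_const' _ _ hcpow, ← lintegral_lintegral_swap hmeas]
      _ ≤ (∫⁻ x, c x ∂ν) * (∫⁻ x, c x ∂ν) ^ (p - 1) := by
          gcongr ?_ * _
          refine lintegral_mono_ae ?_
          filter_upwards [hle, hcfin] with x hx hcx
          rw [lintegral_mul_const' _ _ (ENNReal.rpow_ne_top_of_ne_zero (hc0 x) hcx)]
          calc (∫⁻ y, f x y ^ p ∂μ) * c x ^ (1 - p) ≤ c x ^ p * c x ^ (1 - p) := by
                gcongr
                exact hx.trans (ENNReal.rpow_le_rpow le_self_add hp0.le)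
            _ = c x := by
                rw [← ENNReal.rpow_add _ _ (hc0 x) hcx]; simp
      _ = (∫⁻ x, c x ∂ν) ^ p := by
          nth_rw 1 [← ENNReal.rpow_one (∫⁻ x, c x ∂ν)]
          rw [← ENNReal.rpow_add_of_nonneg _ _ zero_le_one (by linarith)]
          simp
  have hlim : Filter.Tendsto (fun ε : ℝ≥0 => (∫⁻ x, b x ∂ν + ε * ν Set.univ) ^ p)
      (nhdsWithin 0 (Set.Ioi 0)) (nhds ((∫⁻ x, b x ∂ν) ^ p)) := by
    have hcont : Continuous fun ε : ℝ≥0 => (∫⁻ x, b x ∂ν + ε * ν Set.univ) ^ p := by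
      refine ENNReal.continuous_rpow_const.comp (continuous_const.add ?_)
      exact (ENNReal.continuous_mul_const (measure_ne_top ν _)).comp ENNReal.continuous_coe
    have := (hcont.tendsto 0).mono_left (nhdsWithin_le_nhds (s := Set.Ioi 0))
    simpa using this
  exact ge_of_tendsto hlim (Filter.eventually_of_mem self_mem_nhdsWithin fun ε hε => key ε hε)

end Minkowski

section Subgroup

theorem IsCompact.preimage_subgroup_coe {G : Type*} [Group G] [TopologicalSpace G]
    {H : Subgroup G} (hH : IsClosed (H : Set G)) {K : Set G} (hK : IsCompact K) :
    IsCompact ((↑) ⁻¹' K : Set H) :=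
  hH.isClosedEmbedding_subtypeVal.isCompact_preimage hK

variable {G : Type*} [Group G] [TopologicalSpace G] [IsTopologicalGroup G]
  {H : Subgroup G} [LocallyCompactSpace G] [MeasurableSpace G] [BorelSpace G] [LocallyCompactSpace H]

theorem lintegral_lintegral_subgroup (hH : IsClosed (H : Set G)) {w f : G → ℝ≥0}
    (hw : Continuous w) (hwc : HasCompactSupport w) (hf : Continuous f)
    (hfc : HasCompactSupport f) :
    ∫⁻ s, w s * ∫⁻ h : H, f (h * s) ∂haar ∂haar
      = ∫⁻ g, f g * ∫⁻ h : H, w ((h : G)⁻¹ * g) ∂haar ∂haar := by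
  have hsupp : ∀ u : H × G → ℝ≥0, (∀ z, u z ≠ 0 → z.2 ∈ tsupport w ∪ tsupport f
      ∧ (z.1 : G) ∈ (tsupport f * (tsupport w)⁻¹)) → HasCompactSupport u := by
    intro u hu
    refine HasCompactSupport.intro' (K := ((↑) ⁻¹' closure (tsupport f * (tsupport w)⁻¹)) ×ˢ
      (tsupport w ∪ tsupport f)) ?_ ?_ fun z hz => ?_
    · exact (IsCompact.preimage_subgroup_coe hH (hfc.isCompact.mul hwc.isCompact.inv).closure).prod
        (hwc.isCompact.union hfc.isCompact)
    · exact (isClosed_closure.preimage continuous_subtype_val).prod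
        ((isClosed_tsupport _).union (isClosed_tsupport _))
    · by_contra h
      exact hz ⟨subset_closure (hu z h).2, (hu z h).1⟩
  have hc1 : Continuous fun z : H × G => w z.2 * f (z.1 * z.2) := by fun_prop
  have hc2 : Continuous fun z : H × G => f z.2 * w ((z.1 : G)⁻¹ * z.2) := by fun_prop
  have h1 := lintegral_lintegral_swap_of_hasCompactSupport
    (f := fun (h : H) (s : G) => w s * f (h * s)) hc1 (hsupp _ fun z hz => by
      have hz1 := subset_tsupport w (left_ne_zero_of_mul hz)
      have hz2 := subset_tsupport f (right_ne_zero_of_mul hz)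
      exact ⟨Or.inl hz1, _, hz2, _, Set.inv_mem_inv.2 hz1, by simp⟩) haar haar
  have h2 := lintegral_lintegral_swap_of_hasCompactSupport
    (f := fun (h : H) (s : G) => f s * w ((h : G)⁻¹ * s)) hc2 (hsupp _ fun z hz => by
      have hz1 := subset_tsupport f (left_ne_zero_of_mul hz)
      have hz2 := subset_tsupport w (right_ne_zero_of_mul hz)
      exact ⟨Or.inr hz1, _, hz1, _, Set.inv_mem_inv.2 hz2, by simp⟩) haar haar
  simp only [ENNReal.coe_mul] at h1 h2
  simp_rw [lintegral_const_mul' _ _ ENNReal.coe_ne_top] at h1 h2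
  rw [← h1, ← h2]
  refine lintegral_congr fun h => ?_
  rw [← lintegral_mul_left_eq_self (fun y => (f y : ℝ≥0∞) * w ((h : G)⁻¹ * y)) (h : G)]
  simp [mul_comm]

/-- A function on `G` whose integrals over the right cosets of `H` (with respect to the left Haar
measure of `H`) are at most one, and equal to one on the cosets which meet a given compact set. -/
theorem exists_continuous_lintegral_subgroup_eq_one (hH : IsClosed (H : Set G)) {Q : Set G}
    (hQ : IsCompact Q) :
    ∃ w : G → ℝ≥0, Continuous w ∧ HasCompactSupport w ∧
      (∀ g, ∫⁻ h : H, w ((h : G)⁻¹ * g) ∂haar ≤ 1) ∧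
      ∀ g ∈ Q, ∫⁻ h : H, w ((h : G)⁻¹ * g) ∂haar = 1 := by
  rcases Q.eq_empty_or_nonempty with rfl | hQne
  · exact ⟨fun _ => 0, continuous_const, HasCompactSupport.zero, by simp, by simp⟩
  obtain ⟨χ, hχ1, -, hχc, hχ⟩ := exists_continuous_one_zero_of_isCompact hQ
    isClosed_empty (Set.disjoint_empty _)
  set u : G → ℝ≥0 := fun g => (χ g).toNNReal
  have hu : Continuous u := continuous_real_toNNReal.comp χ.2
  have huc : HasCompactSupport u := hχc.comp_left (g := Real.toNNReal) Real.toNNReal_zero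
  obtain ⟨W, hW, hWu⟩ := exists_continuous_eq_lintegral
    (f := fun (g : G) (h : H) => u ((h : G)⁻¹ * g)) (by fun_prop) (fun C hC => by
      refine ⟨_, IsCompact.preimage_subgroup_coe hH (hC.mul huc.isCompact.inv), fun g hg h hne => ?_⟩
      exact ⟨g, hg, _, Set.inv_mem_inv.2 (subset_tsupport u hne), by simp⟩) haar
  have hWpos : ∀ g ∈ Q, 0 < W g := by
    intro g hg
    rw [← ENNReal.coe_pos, ← hWu, lintegral_pos_iff_support (by fun_prop)]
    refine IsOpen.measure_pos _ ?_ ⟨1, ?_⟩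
    · exact isOpen_ne_fun (by fun_prop) continuous_const
    · simp [u, hχ1 hg]
  obtain ⟨q, hq, hmin⟩ := hQ.exists_isMinOn hQne hW.continuousOn
  have hε := hWpos q hq
  have hWinv : ∀ (h : H) g, W ((h : G)⁻¹ * g) = W g := by
    intro h g
    rw [← ENNReal.coe_inj, ← hWu, ← hWu,
      ← lintegral_mul_left_eq_self (fun k : H => (u ((k : G)⁻¹ * g) : ℝ≥0∞)) h]
    simp [mul_assoc]
  have hmax : ∀ g, max (W g) (W q) ≠ 0 := fun g => (lt_max_of_lt_right hε).ne'
  have hint : ∀ g, ∫⁻ h : H, ((u ((h : G)⁻¹ * g) / max (W ((h : G)⁻¹ * g)) (W q) : ℝ≥0) : ℝ≥0∞) ∂haar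
      = (W g / max (W g) (W q) : ℝ≥0) := by
    intro g
    simp_rw [hWinv, ENNReal.coe_div (hmax g), ENNReal.div_eq_inv_mul]
    rw [lintegral_const_mul _ (by fun_prop), hWu]
  refine ⟨fun g => u g / max (W g) (W q), hu.div (hW.max continuous_const) hmax, ?_, ?_, ?_⟩
  · simp_rw [div_eq_mul_inv]
    exact huc.mul_right
  · intro g
    rw [hint]
    exact_mod_cast div_le_one_of_le₀ (le_max_left _ _) bot_le
  · intro g hg
    rw [hint, max_eq_left (hmin hg), div_self (hWpos g hg).ne', ENNReal.coe_one]

end Subgroup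

section TwistedConvolution

variable {G : Type*} [Group G] [TopologicalSpace G] [IsTopologicalGroup G]
  [LocallyCompactSpace G] [MeasurableSpace G] [BorelSpace G]

/-- The convolution of `f₁` with `f₂ Δ^c`, for functions with values in `[0, ∞]`. -/
noncomputable def twistedConvolution (c : ℝ) (f₁ f₂ : G → ℝ≥0∞) (g' : G) : ℝ≥0∞ :=
  ∫⁻ g, f₁ g * (f₂ (g⁻¹ * g') * (modularCharacter (g⁻¹ * g') ^ (-c) : ℝ≥0)) ∂haar

theorem continuous_modularCharacter_rpow {G : Type*} [Group G] [TopologicalSpace G] [IsTopologicalGroup G]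
    [LocallyCompactSpace G] (c : ℝ) :
    Continuous fun g : G => (modularCharacter g ^ c : ℝ≥0) := by
  rw [continuous_iff_continuousAt]
  exact fun g => continuous_modularCharacter.continuousAt.nnrpow continuousAt_const
    (Or.inl (modularCharacter_ne_zero g))

theorem exists_continuous_eq_twistedConvolution (c : ℝ) {f₁ f₂ : G → ℝ≥0} (hf₁ : Continuous f₁)
    (hf₁c : HasCompactSupport f₁) (hf₂ : Continuous f₂) :
    ∃ F : G → ℝ≥0, Continuous F ∧
      ∀ g, twistedConvolution c (fun x => f₁ x) (fun x => f₂ x) g = F g := by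
  have hm := continuous_modularCharacter_rpow (G := G) (-c)
  obtain ⟨F, hF, h⟩ := exists_continuous_eq_lintegral
    (f := fun (g' g : G) => f₁ g * (f₂ (g⁻¹ * g') * modularCharacter (g⁻¹ * g') ^ (-c)))
    (by
      change Continuous fun z : G × G => f₁ z.2 * (f₂ (z.2⁻¹ * z.1)
        * modularCharacter (z.2⁻¹ * z.1) ^ (-c))
      exact (hf₁.comp continuous_snd).mul ((hf₂.comp (by fun_prop)).mul
        (hm.comp (g := fun g : G => modularCharacter g ^ (-c)) (by fun_prop))))
    (fun C _ => ⟨_, hf₁c.isCompact, fun _ _ y hy =>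
      subset_tsupport _ (left_ne_zero_of_mul hy)⟩) (haar : Measure G)
  refine ⟨F, hF, fun g => ?_⟩
  rw [← h]
  simp [twistedConvolution]

theorem coe_modularFunction_rpow {G : Type*} [Group G] [TopologicalSpace G] [IsTopologicalGroup G]
    [LocallyCompactSpace G] (c : ℝ) (g : G) :
    (modularFunction g ^ c : ℝ) = ((modularCharacter g ^ (-c) : ℝ≥0) : ℝ) := by
  rw [modularFunction, Real.inv_rpow (by positivity), NNReal.coe_rpow, Real.rpow_neg (by positivity)]

theorem enorm_haarConvolution_le (c : ℝ) (φ₁ φ₂ : G → ℂ) (g' : G) :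
    ‖haarConvolution φ₁ (fun g => φ₂ g * ((modularFunction g ^ c : ℝ) : ℂ)) g'‖ₑ
      ≤ twistedConvolution c (fun g => ‖φ₁ g‖ₑ) (fun g => ‖φ₂ g‖ₑ) g' := by
  refine (enorm_integral_le_lintegral_enorm _).trans (lintegral_mono fun g => le_of_eq ?_)
  simp only [coe_modularFunction_rpow, enorm_eq_nnnorm, nnnorm_mul, ENNReal.coe_mul, Complex.nnnorm_real,
    NNReal.nnnorm_eq]

theorem eLpNorm_coe_eq {α : Type*} [MeasurableSpace α] {p : ℝ≥0∞} (hp0 : p ≠ 0) (hp : p ≠ ∞)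
    (μ : Measure α) (f : α → ℝ≥0) :
    eLpNorm (fun g => ((f g : ℝ) : ℂ)) p μ
      = (∫⁻ g, (f g : ℝ≥0∞) ^ p.toReal ∂μ) ^ (1 / p.toReal) := by
  rw [eLpNorm_eq_lintegral_rpow_enorm_toReal hp0 hp]
  congr 2
  funext g
  congr 1
  rw [enorm_eq_nnnorm]
  simp

/-- Young's inequality with the optimal constant, for nonnegative continuous functions with compact
support. -/
theorem lintegral_twistedConvolution_le {p₁ p₂ : ℝ≥0∞} (hp₁0 : p₁ ≠ 0) (hp₁ : p₁ ≠ ∞)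
    (hp₂0 : p₂ ≠ 0) (hp₂ : p₂ ≠ ∞)
    (hp0 : youngExponent p₁ p₂ ≠ 0) (hp : youngExponent p₁ p₂ ≠ ∞) {f₁ f₂ : G → ℝ≥0}
    (hf₁ : Continuous f₁) (hf₁c : HasCompactSupport f₁) (hf₂ : Continuous f₂)
    (hf₂c : HasCompactSupport f₂) :
    (∫⁻ g, twistedConvolution ((ENNReal.conjExponent p₁)⁻¹).toReal (fun x => f₁ x) (fun x => f₂ x) g
        ^ (youngExponent p₁ p₂).toReal ∂haar) ^ (1 / (youngExponent p₁ p₂).toReal)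
      ≤ youngConst p₁ p₂ G
        * ((∫⁻ g, (f₁ g : ℝ≥0∞) ^ p₁.toReal ∂haar) ^ (1 / p₁.toReal)
          * (∫⁻ g, (f₂ g : ℝ≥0∞) ^ p₂.toReal ∂haar) ^ (1 / p₂.toReal)) := by
  set c := ((ENNReal.conjExponent p₁)⁻¹).toReal
  set p := youngExponent p₁ p₂
  have hnorm : ∀ {q : ℝ≥0∞} (_ : q ≠ 0) (_ : q ≠ ∞) {f : G → ℝ≥0} (_ : Continuous f)
      (_ : HasCompactSupport f), ∃ n : ℝ≥0,
        (∫⁻ g, (f g : ℝ≥0∞) ^ q.toReal ∂(haar : Measure G)) ^ (1 / q.toReal) = n ∧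
        (n = 0 → f = 0) := by
    intro q hq0 hq f hf hfc
    have hcont : Continuous fun g => ((f g : ℝ) : ℂ) :=
      Complex.continuous_ofReal.comp (NNReal.continuous_coe.comp hf)
    have hmem : MemLp (fun g => ((f g : ℝ) : ℂ)) q (haar : Measure G) :=
      hcont.memLp_of_hasCompactSupport (hfc.comp_left (g := fun x : ℝ≥0 => ((x : ℝ) : ℂ)) (by simp))
    rw [← eLpNorm_coe_eq hq0 hq]
    refine ⟨_, (ENNReal.coe_toNNReal hmem.eLpNorm_ne_top).symm, fun h0 => ?_⟩
    rw [ENNReal.toNNReal_eq_zero_iff, or_iff_left hmem.eLpNorm_ne_top,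
      eLpNorm_eq_zero_iff hmem.1 hq0] at h0
    have := (hcont.ae_eq_iff_eq haar continuous_const).1 h0
    funext g
    have hg : ((f g : ℝ) : ℂ) = 0 := congrFun this g
    change f g = 0
    exact_mod_cast hg
  obtain ⟨n₁, hn₁, h₁⟩ := hnorm hp₁0 hp₁ hf₁ hf₁c
  obtain ⟨n₂, hn₂, h₂⟩ := hnorm hp₂0 hp₂ hf₂ hf₂c
  have hp_pos := ENNReal.toReal_pos hp0 hp
  obtain ⟨F, hF, hFc⟩ := exists_continuous_eq_twistedConvolution c hf₁ hf₁c hf₂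
  rw [hn₁, hn₂]
  simp_rw [hFc]
  by_cases hn : n₁ = 0 ∨ n₂ = 0
  · have hz : ∀ g, (F g : ℝ≥0∞) = 0 := by
      intro g
      rw [← hFc]
      rcases hn with h | h
      · simp [twistedConvolution, h₁ h]
      · simp [twistedConvolution, h₂ h]
    simp [hz, hp_pos]
  obtain ⟨hn₁0, hn₂0⟩ := not_or.1 hn
  set φ₁ : G → ℂ := fun g => ((f₁ g / n₁ : ℝ≥0) : ℝ)
  set φ₂ : G → ℂ := fun g => ((f₂ g / n₂ : ℝ≥0) : ℝ)
  have hdiv : ∀ {q : ℝ≥0∞} (_ : q ≠ 0) (_ : q ≠ ∞) (f : G → ℝ≥0) {n : ℝ≥0} (_ : n ≠ 0),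
      eLpNorm (fun g => (((f g / n : ℝ≥0) : ℝ) : ℂ)) q (haar : Measure G)
        = (∫⁻ g, (f g : ℝ≥0∞) ^ q.toReal ∂haar) ^ (1 / q.toReal) / n := by
    intro q hq0 hq f n hn
    have : (fun g => (((f g / n : ℝ≥0) : ℝ) : ℂ)) = ((n⁻¹ : ℝ≥0) : ℂ) • fun g => ((f g : ℝ) : ℂ) := by
      funext g; simp [div_eq_inv_mul]
    rw [this, eLpNorm_const_smul, eLpNorm_coe_eq hq0 hq, ENNReal.div_eq_inv_mul,
      ← ENNReal.coe_inv hn]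
    congr 1
    rw [enorm_eq_nnnorm]
    simp
  have hmeas : ∀ {f : G → ℝ≥0} (n : ℝ≥0), Continuous f →
      Measurable fun g => (((f g / n : ℝ≥0) : ℝ) : ℂ) := fun n hf =>
    (Complex.continuous_ofReal.comp (NNReal.continuous_coe.comp (hf.div_const n))).measurable
  have hconv : haarConvolution φ₁ (fun g => φ₂ g * ((modularFunction g ^ c : ℝ) : ℂ))
      = fun g => (((F g / (n₁ * n₂) : ℝ≥0) : ℝ) : ℂ) := by
    funext g'
    set k : G → ℝ≥0 := fun g =>
      f₁ g / n₁ * (f₂ (g⁻¹ * g') / n₂ * modularCharacter (g⁻¹ * g') ^ (-c))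
    have hk : Continuous k :=
      (hf₁.div_const n₁).mul (((hf₂.comp (by fun_prop)).div_const n₂).mul
        ((continuous_modularCharacter_rpow (-c)).comp
          (g := fun g : G => modularCharacter g ^ (-c)) (by fun_prop)))
    have h1 := integral_eq_lintegral_of_nonneg_ae (μ := haar) (f := fun y => (k y : ℝ))
      (ae_of_all _ fun y => (k y).2)
      (NNReal.continuous_coe.comp hk).measurable.aestronglyMeasurable
    have h2 : ∫⁻ g, (k g : ℝ≥0∞) ∂haar = (F g' / (n₁ * n₂) : ℝ≥0) := by
      rw [ENNReal.coe_div (mul_ne_zero hn₁0 hn₂0), ← hFc, twistedConvolution,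
        ENNReal.div_eq_inv_mul, ← ENNReal.coe_inv (mul_ne_zero hn₁0 hn₂0),
        ← lintegral_const_mul' _ _ ENNReal.coe_ne_top]
      refine lintegral_congr fun g => ?_
      simp only [← ENNReal.coe_mul, ENNReal.coe_inj, k]
      rw [mul_inv]
      ring
    simp only [ENNReal.ofReal_coe_nnreal] at h1
    rw [h2, ENNReal.coe_toReal] at h1
    rw [← h1, ← integral_complex_ofReal]
    refine integral_congr_ae (ae_of_all _ fun g => ?_)
    simp only [φ₁, φ₂, k, coe_modularFunction_rpow]
    push_cast
    ring
  have hle : eLpNorm (haarConvolution φ₁ (fun g => φ₂ g * ((modularFunction g ^ c : ℝ) : ℂ))) p haar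
      ≤ youngConst p₁ p₂ G := by
    refine le_sSup ⟨φ₁, φ₂, hmeas n₁ hf₁, hmeas n₂ hf₂, ?_, ?_, rfl⟩
    · rw [hdiv hp₁0 hp₁ f₁ hn₁0, hn₁, ENNReal.div_self (by simpa) ENNReal.coe_ne_top]
    · rw [hdiv hp₂0 hp₂ f₂ hn₂0, hn₂, ENNReal.div_self (by simpa) ENNReal.coe_ne_top]
  rw [hconv, hdiv hp0 hp F (mul_ne_zero hn₁0 hn₂0), ENNReal.div_le_iff (by simp [hn₁0, hn₂0])
    ENNReal.coe_ne_top] at hle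
  rwa [← ENNReal.coe_mul]

end TwistedConvolution

/-- A Schur test with three exponents. -/
theorem lintegral_lintegral_mul_rpow_le {α : Type*} [MeasurableSpace α] {ν : Measure α} [SFinite ν]
    {q₁ q₂ q : ℝ} (hq₁ : 1 ≤ q₁) (hq₂ : 1 ≤ q₂) (hq : 0 < q) (hqq : 1 / q₁ + 1 / q₂ = 1 + 1 / q)
    {a : α → ℝ≥0∞} {b₁ b₂ : α → α → ℝ≥0∞} (ha : AEMeasurable a ν)
    (hb₁ : ∀ t, AEMeasurable (fun s => b₁ s t) ν) (hb₂ : ∀ t, AEMeasurable (fun s => b₂ s t) ν)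
    (hb₁' : ∀ s, AEMeasurable (b₁ s) ν)
    (hab : AEMeasurable (Function.uncurry fun s t => a s * b₁ s t) (ν.prod ν)) {N₁ N₂ : ℝ≥0∞}
    (hN₁ : N₁ ≠ ∞) (hN₂ : N₂ ≠ ∞) (hale : ∫⁻ s, a s ∂ν ≤ N₁)
    (hb₁le : ∀ s, ∫⁻ t, b₁ s t ∂ν ≤ N₂) (hb₂le : ∀ t, ∫⁻ s, b₂ s t ∂ν ≤ N₂) :
    ∫⁻ t, (∫⁻ s, a s ^ (1 / q₁) * (b₁ s t ^ (1 / q) * b₂ s t ^ (1 - 1 / q₁)) ∂ν) ^ q ∂ν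
      ≤ N₁ ^ (q / q₁) * N₂ ^ (q / q₂) := by
  have h₁ : 0 ≤ 1 - 1 / q₁ := by
    rw [sub_nonneg, div_le_one (by linarith)]; exact hq₁
  have h₂ : 0 ≤ 1 - 1 / q₂ := by
    rw [sub_nonneg, div_le_one (by linarith)]; exact hq₂
  have hpt : ∀ t, (∫⁻ s, a s ^ (1 / q₁) * (b₁ s t ^ (1 / q) * b₂ s t ^ (1 - 1 / q₁)) ∂ν) ^ q
      ≤ (∫⁻ s, a s * b₁ s t ∂ν) * (N₁ ^ (q * (1 - 1 / q₂)) * N₂ ^ (q * (1 - 1 / q₁))) := by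
    intro t
    have hmeas : ∀ i ∈ (Finset.univ : Finset (Fin 3)),
        AEMeasurable (![fun s => a s * b₁ s t, a, fun s => b₂ s t] i) ν := by
      intro i _
      fin_cases i
      exacts [ha.mul (hb₁ t), ha, hb₂ t]
    have h := ENNReal.lintegral_prod_norm_pow_le Finset.univ hmeas
      (p := ![1 / q, 1 - 1 / q₂, 1 - 1 / q₁]) (by
        simp [Fin.sum_univ_three]; simp at hqq; linarith) (by
        intro i _
        fin_cases i
        exacts [by simpa using hq.le, h₂, h₁])
    simp only [Fin.prod_univ_three, Matrix.cons_val_zero, Matrix.cons_val_one,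
      Matrix.cons_val] at h
    have heq : ∀ s, a s ^ (1 / q₁) * (b₁ s t ^ (1 / q) * b₂ s t ^ (1 - 1 / q₁))
        = (a s * b₁ s t) ^ (1 / q) * a s ^ (1 - 1 / q₂) * b₂ s t ^ (1 - 1 / q₁) := by
      intro s
      have : 1 / q₁ = 1 / q + (1 - 1 / q₂) := by linarith
      rw [this, ENNReal.rpow_add_of_nonneg _ _ (by positivity) h₂,
        ENNReal.mul_rpow_of_nonneg _ _ (by positivity), ← this]
      ring
    simp_rw [heq]
    calc _ ≤ ((∫⁻ s, a s * b₁ s t ∂ν) ^ (1 / q) * N₁ ^ (1 - 1 / q₂) * N₂ ^ (1 - 1 / q₁)) ^ q := by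
          refine ENNReal.rpow_le_rpow (h.trans ?_) hq.le
          gcongr
          exact hb₂le t
      _ = _ := by
          rw [ENNReal.mul_rpow_of_nonneg _ _ hq.le, ENNReal.mul_rpow_of_nonneg _ _ hq.le,
            ← ENNReal.rpow_mul, ← ENNReal.rpow_mul, ← ENNReal.rpow_mul,
            one_div_mul_cancel hq.ne', ENNReal.rpow_one, mul_comm q, mul_comm q, mul_assoc]
  have hc : N₁ ^ (q * (1 - 1 / q₂)) * N₂ ^ (q * (1 - 1 / q₁)) ≠ ∞ :=
    ENNReal.mul_ne_top (ENNReal.rpow_ne_top_of_nonneg (by positivity) hN₁)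
      (ENNReal.rpow_ne_top_of_nonneg (by positivity) hN₂)
  calc _ ≤ ∫⁻ t, (∫⁻ s, a s * b₁ s t ∂ν)
        * (N₁ ^ (q * (1 - 1 / q₂)) * N₂ ^ (q * (1 - 1 / q₁))) ∂ν := lintegral_mono hpt
    _ = (∫⁻ s, a s * ∫⁻ t, b₁ s t ∂ν ∂ν)
        * (N₁ ^ (q * (1 - 1 / q₂)) * N₂ ^ (q * (1 - 1 / q₁))) := by
        rw [lintegral_mul_const' _ _ hc, ← lintegral_lintegral_swap hab]
        simp_rw [fun s => lintegral_const_mul'' (a s) (hb₁' s)]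
    _ ≤ (N₁ * N₂) * (N₁ ^ (q * (1 - 1 / q₂)) * N₂ ^ (q * (1 - 1 / q₁))) := by
        gcongr
        calc ∫⁻ s, a s * ∫⁻ t, b₁ s t ∂ν ∂ν ≤ ∫⁻ s, a s * N₂ ∂ν := by
              gcongr with s
              exact hb₁le s
          _ = (∫⁻ s, a s ∂ν) * N₂ := lintegral_mul_const' _ _ hN₂
          _ ≤ N₁ * N₂ := by gcongr
    _ = (N₁ * N₁ ^ (q * (1 - 1 / q₂))) * (N₂ * N₂ ^ (q * (1 - 1 / q₁))) := by ring
    _ = _ := by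
        have hpow : ∀ (N : ℝ≥0∞) {x : ℝ}, 0 ≤ x → N * N ^ x = N ^ (1 + x) := fun N x hx => by
          rw [ENNReal.rpow_add_of_nonneg _ _ zero_le_one hx, ENNReal.rpow_one]
        rw [hpow N₁ (by positivity), hpow N₂ (by positivity)]
        have e₁ : 1 + q * (1 - 1 / q₂) = q / q₁ := by
          have : 1 / q₁ = 1 + 1 / q - 1 / q₂ := by linarith
          rw [div_eq_mul_one_div q q₁, this]; field_simp; ring
        have e₂ : 1 + q * (1 - 1 / q₁) = q / q₂ := by
          have : 1 / q₂ = 1 + 1 / q - 1 / q₁ := by linarith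
          rw [div_eq_mul_one_div q q₂, this]; field_simp; ring
        rw [e₁, e₂]

section Subgroup

variable {G : Type*} [Group G] [TopologicalSpace G] [IsTopologicalGroup G]
  {H : Subgroup G}

theorem HasCompactSupport.comp_mul_subgroup_mul (hH : IsClosed (H : Set G)) {α : Type*} [Zero α]
    {f : G → α} (hf : HasCompactSupport f) (s t : G) :
    HasCompactSupport fun h : H => f (s * h * t) :=
  hf.comp_isClosedEmbedding ((((Homeomorph.mulLeft s).trans
    (Homeomorph.mulRight t)).isClosedEmbedding).comp hH.isClosedEmbedding_subtypeVal)

variable [LocallyCompactSpace G] [MeasurableSpace G] [BorelSpace G] [LocallyCompactSpace H]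

theorem exists_continuous_eq_lintegral_subgroup (hH : IsClosed (H : Set G)) {f : G → ℝ≥0}
    (hf : Continuous f) (hfc : HasCompactSupport f) {κ : H → ℝ≥0} (hκ : Continuous κ) :
    ∃ v : G × G → ℝ≥0, Continuous v ∧
      ∀ s t, ∫⁻ h : H, f (s⁻¹ * h * t) * κ h ∂haar = v (s, t) := by
  obtain ⟨v, hv, h⟩ := exists_continuous_eq_lintegral
    (f := fun (z : G × G) (h : H) => f (z.1⁻¹ * h * z.2) * κ h) (by fun_prop)
    (fun C hC => ⟨_, IsCompact.preimage_subgroup_coe hH (((hC.image continuous_fst).mul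
      hfc.isCompact).mul (hC.image continuous_snd).inv), fun z hz h hne =>
        ⟨z.1 * (z.1⁻¹ * h * z.2), Set.mul_mem_mul ⟨z, hz, rfl⟩
          (subset_tsupport _ (left_ne_zero_of_mul hne)), z.2⁻¹,
          Set.inv_mem_inv.2 ⟨z, hz, rfl⟩, by group⟩⟩) (haar : Measure H)
  exact ⟨v, hv, fun s t => by simpa using h (s, t)⟩

theorem lintegral_withDensity_subgroup (hH : IsClosed (H : Set G)) {w f : G → ℝ≥0}
    (hw : Continuous w) (hwc : HasCompactSupport w) (hf : Continuous f)
    (hfc : HasCompactSupport f) :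
    ∫⁻ s, ∫⁻ h : H, f (h * s) ∂haar ∂(haar.withDensity fun g => (w g : ℝ≥0∞))
      = ∫⁻ g, f g * ∫⁻ h : H, w ((h : G)⁻¹ * g) ∂haar ∂haar := by
  rw [← lintegral_lintegral_subgroup hH hw hwc hf hfc]
  obtain ⟨v, hv, h⟩ := exists_continuous_eq_lintegral_subgroup hH hf hfc (continuous_const (y := 1))
  have h' : ∀ s, ∫⁻ x : H, f (x * s) ∂haar = v (1, s) := fun s => by simpa using h 1 s
  simp_rw [h']
  exact lintegral_withDensity_eq_lintegral_mul _ (by fun_prop)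
    (hv.comp (Continuous.prodMk_right 1)).measurable.coe_nnreal_ennreal

theorem lintegral_withDensity_subgroup_le (hH : IsClosed (H : Set G)) {w f : G → ℝ≥0}
    (hw : Continuous w) (hwc : HasCompactSupport w)
    (hw1 : ∀ g, ∫⁻ h : H, w ((h : G)⁻¹ * g) ∂haar ≤ 1) (hf : Continuous f)
    (hfc : HasCompactSupport f) :
    ∫⁻ s, ∫⁻ h : H, f (h * s) ∂haar ∂(haar.withDensity fun g => (w g : ℝ≥0∞))
      ≤ ∫⁻ g, f g ∂haar := by
  rw [lintegral_withDensity_subgroup hH hw hwc hf hfc]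
  exact lintegral_mono fun g => mul_le_of_le_one_right' (hw1 g)

theorem lintegral_withDensity_subgroup_eq (hH : IsClosed (H : Set G)) {w f : G → ℝ≥0}
    (hw : Continuous w) (hwc : HasCompactSupport w) (hf : Continuous f)
    (hfc : HasCompactSupport f) (hw1 : ∀ g, f g ≠ 0 → ∫⁻ h : H, w ((h : G)⁻¹ * g) ∂haar = 1) :
    ∫⁻ s, ∫⁻ h : H, f (h * s) ∂haar ∂(haar.withDensity fun g => (w g : ℝ≥0∞))
      = ∫⁻ g, f g ∂haar := by
  rw [lintegral_withDensity_subgroup hH hw hwc hf hfc]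
  refine lintegral_congr fun g => ?_
  by_cases h : f g = 0
  · simp [h]
  · rw [hw1 g h, mul_one]

end Subgroup

section Subgroup

variable {G : Type*} [Group G] [TopologicalSpace G] [IsTopologicalGroup G]
  [LocallyCompactSpace G] [MeasurableSpace G] [BorelSpace G]

theorem lintegral_inv_mul_modularCharacter {φ : G → ℝ≥0∞} (hφ : Measurable φ) (t : G) :
    ∫⁻ g, φ (g⁻¹ * t) * ((modularCharacter (g⁻¹ * t))⁻¹ : ℝ≥0) ∂haar = ∫⁻ g, φ g ∂haar := by
  rw [← lintegral_haar_inv hφ, ← lintegral_mul_left_eq_self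
      (fun g => φ (g⁻¹ * t) * ((modularCharacter (g⁻¹ * t))⁻¹ : ℝ≥0)) t]
  refine lintegral_congr fun g => ?_
  rw [mul_inv_rev, inv_mul_cancel_right, map_inv, inv_inv]

variable {H : Subgroup G} [LocallyCompactSpace H]

/-- The fibrewise form of Young's inequality: the estimate on `H`, applied to the restrictions of
the functions to the cosets `H s` and `s⁻¹ H t`. -/
theorem lintegral_fiber_le (hH : IsClosed (H : Set G)) {q₁ q₂ q : ℝ} (hq₁ : 1 ≤ q₁) (hq₂ : 1 ≤ q₂)
    (hq : 0 < q) (hqq : 1 / q₁ + 1 / q₂ = 1 + 1 / q) {Y : ℝ≥0∞}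
    (hY : ∀ a b : H → ℝ≥0, Continuous a → HasCompactSupport a → Continuous b →
      HasCompactSupport b →
      (∫⁻ h, twistedConvolution (1 - 1 / q₁) (fun x => a x) (fun x => b x) h ^ q ∂haar) ^ (1 / q)
        ≤ Y * ((∫⁻ h, (a h : ℝ≥0∞) ^ q₁ ∂haar) ^ (1 / q₁)
          * (∫⁻ h, (b h : ℝ≥0∞) ^ q₂ ∂haar) ^ (1 / q₂)))
    {f₁ f₂ : G → ℝ≥0} (hf₁ : Continuous f₁) (hf₁c : HasCompactSupport f₁) (hf₂ : Continuous f₂)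
    (hf₂c : HasCompactSupport f₂) (s t : G) :
    ∫⁻ h' : H, (∫⁻ h : H, (f₁ (h * s) * (f₂ (s⁻¹ * (h : G)⁻¹ * h' * t)
        * modularCharacter (s⁻¹ * (h : G)⁻¹ * h' * t) ^ (-(1 - 1 / q₁))) : ℝ≥0) ∂haar) ^ q ∂haar
      ≤ (Y * ((∫⁻ h : H, (f₁ (h * s) ^ q₁ : ℝ≥0) ∂haar) ^ (1 / q₁)
        * ((∫⁻ h : H, (f₂ (s⁻¹ * h * t) ^ q₂ : ℝ≥0) ∂haar) ^ (1 / q)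
          * (∫⁻ h : H, (f₂ (s⁻¹ * h * t) ^ q₂ * (modularCharacter (s⁻¹ * h * t))⁻¹
            * modularCharacter h : ℝ≥0) ∂haar) ^ (1 - 1 / q₁)))) ^ q := by
  have hq₁0 : 0 < q₁ := by linarith
  have hq₂0 : 0 < q₂ := by linarith
  have hc : 0 ≤ 1 - 1 / q₁ := by
    rw [sub_nonneg, div_le_one (by linarith)]; exact hq₁
  have hmG := continuous_modularCharacter (G := G)
  have hmH := continuous_modularCharacter (G := H)
  set c := 1 - 1 / q₁ with hcdef
  set a : H → ℝ≥0 := fun h => f₁ (h * s)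
  set b : H → ℝ≥0 := fun h => f₂ (s⁻¹ * h * t) * modularCharacter (s⁻¹ * h * t) ^ (-c)
    * modularCharacter h ^ c
  have ha : Continuous a := by fun_prop
  have hac : HasCompactSupport a := by
    simpa using hf₁c.comp_mul_subgroup_mul hH 1 s
  have hb : Continuous b := by
    refine (Continuous.mul (by fun_prop) ?_).mul (continuous_modularCharacter_rpow c)
    exact (continuous_modularCharacter_rpow (G := G) (-c)).comp
      (g := fun g : G => modularCharacter g ^ (-c)) (by fun_prop)
  have hbc : HasCompactSupport b :=
    (hf₂c.comp_mul_subgroup_mul hH s⁻¹ t).mul_right.mul_right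
  have hconv : ∀ h' : H, twistedConvolution c (fun x => a x) (fun x => b x) h'
      = ∫⁻ h : H, (f₁ (h * s) * (f₂ (s⁻¹ * (h : G)⁻¹ * h' * t)
        * modularCharacter (s⁻¹ * (h : G)⁻¹ * h' * t) ^ (-c)) : ℝ≥0) ∂haar := by
    intro h'
    refine lintegral_congr fun h => ?_
    simp only [← ENNReal.coe_mul, ENNReal.coe_inj, a, b]
    rw [mul_assoc _ (modularCharacter (h⁻¹ * h') ^ c),
      ← NNReal.rpow_add (modularCharacter_ne_zero _), add_neg_cancel, NNReal.rpow_zero, mul_one]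
    simp [mul_assoc]
  have h1 := hY a b ha hac hb hbc
  simp_rw [hconv] at h1
  have h2 : (∫⁻ h, (b h : ℝ≥0∞) ^ q₂ ∂haar) ^ (1 / q₂)
      ≤ (∫⁻ h : H, (f₂ (s⁻¹ * h * t) ^ q₂ : ℝ≥0) ∂haar) ^ (1 / q)
          * (∫⁻ h : H, (f₂ (s⁻¹ * h * t) ^ q₂ * (modularCharacter (s⁻¹ * h * t))⁻¹
            * modularCharacter h : ℝ≥0) ∂haar) ^ c := by
    have hcq : c = 1 / q₂ - 1 / q := by linarith
    have hθ : q₂ / q + c * q₂ = 1 := by rw [hcq]; field_simp; ring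
    have hxmk : ∀ x m k : ℝ≥0, (x * m ^ (-c) * k ^ c) ^ q₂
        = (x ^ q₂) ^ (q₂ / q) * (x ^ q₂ * m⁻¹ * k) ^ (c * q₂) := by
      intro x m k
      have hx : (x ^ q₂) ^ (q₂ / q) * (x ^ q₂) ^ (c * q₂) = x ^ q₂ := by
        rw [← NNReal.rpow_add_of_nonneg _ (by positivity) (by positivity), hθ, NNReal.rpow_one]
      simp only [NNReal.mul_rpow]
      rw [← mul_assoc, ← mul_assoc, hx, ← NNReal.rpow_mul m, ← NNReal.rpow_mul k, NNReal.inv_rpow,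
        neg_mul, NNReal.rpow_neg]
    have hpt : ∀ h : H, (b h : ℝ≥0∞) ^ q₂ = ((f₂ (s⁻¹ * h * t) ^ q₂ : ℝ≥0) : ℝ≥0∞) ^ (q₂ / q)
        * ((f₂ (s⁻¹ * h * t) ^ q₂ * (modularCharacter (s⁻¹ * h * t))⁻¹
            * modularCharacter h : ℝ≥0) : ℝ≥0∞) ^ (c * q₂) := by
      intro h
      have e1 : 0 ≤ q₂ / q := by positivity
      have e2 : 0 ≤ c * q₂ := by positivity
      rw [← ENNReal.coe_rpow_of_nonneg _ hq₂0.le, ← ENNReal.coe_rpow_of_nonneg _ e1,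
        ← ENNReal.coe_rpow_of_nonneg _ e2, ← ENNReal.coe_mul, ENNReal.coe_inj]
      simp only [b]
      exact hxmk _ _ _
    simp_rw [hpt]
    have hA : Continuous fun h : H => f₂ (s⁻¹ * h * t) ^ q₂ :=
      (NNReal.continuous_rpow_const hq₂0.le).comp (by fun_prop)
    have h3 := ENNReal.lintegral_mul_norm_pow_le (μ := (haar : Measure H)) (p := q₂ / q)
      (q := c * q₂) (f := fun h : H => ((f₂ (s⁻¹ * h * t) ^ q₂ : ℝ≥0) : ℝ≥0∞))
      (g := fun h : H => ((f₂ (s⁻¹ * h * t) ^ q₂ * (modularCharacter (s⁻¹ * h * t))⁻¹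
            * modularCharacter h : ℝ≥0) : ℝ≥0∞)) ?_ ?_ (by positivity) (by positivity) hθ
    · refine (ENNReal.rpow_le_rpow h3 (by positivity)).trans (le_of_eq ?_)
      rw [ENNReal.mul_rpow_of_nonneg _ _ (by positivity), ← ENNReal.rpow_mul, ← ENNReal.rpow_mul]
      congr 2 <;> field_simp
    · exact hA.measurable.coe_nnreal_ennreal.aemeasurable
    · exact ((hA.mul ((hmG.comp (by fun_prop)).inv₀ fun h => modularCharacter_ne_zero _)).mul
        hmH).measurable.coe_nnreal_ennreal.aemeasurable
  have h4 : ∀ h : H, (a h : ℝ≥0∞) ^ q₁ = (f₁ (h * s) ^ q₁ : ℝ≥0) := fun h =>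
    (ENNReal.coe_rpow_of_nonneg _ hq₁0.le).symm
  simp_rw [h4] at h1
  rw [one_div q, ENNReal.rpow_inv_le_iff hq] at h1
  refine h1.trans (ENNReal.rpow_le_rpow ?_ hq.le)
  gcongr

end Subgroup

theorem lintegral_ne_top_of_hasCompactSupport {X : Type*} [TopologicalSpace X] [MeasurableSpace X]
    [OpensMeasurableSpace X] {f : X → ℝ≥0} (hf : Continuous f) (hfc : HasCompactSupport f)
    (μ : Measure X) [IsFiniteMeasureOnCompacts μ] : ∫⁻ x, (f x : ℝ≥0∞) ∂μ ≠ ∞ := by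
  rw [← setLIntegral_eq_of_support_subset (s := tsupport f) fun y hy =>
    subset_tsupport _ fun h0 => hy (by simp [h0])]
  exact (setLIntegral_lt_top_of_isCompact hfc.isCompact.measure_lt_top.ne hfc.isCompact hf).ne

theorem withDensity_compl_tsupport {X : Type*} [TopologicalSpace X] [MeasurableSpace X]
    [OpensMeasurableSpace X] (w : X → ℝ≥0) (μ : Measure X) :
    μ.withDensity (fun x => (w x : ℝ≥0∞)) (tsupport w)ᶜ = 0 := by
  have hms : MeasurableSet (tsupport w)ᶜ := (isClosed_tsupport w).measurableSet.compl
  rw [withDensity_apply _ hms, setLIntegral_congr_fun (g := fun _ => 0) hms fun x hx => ?_,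
    lintegral_zero]
  simpa using image_eq_zero_of_notMem_tsupport hx

section Subgroup

variable {G : Type*} [Group G] [TopologicalSpace G] [IsTopologicalGroup G]
  [LocallyCompactSpace G] [MeasurableSpace G] [BorelSpace G]
  {H : Subgroup G} [LocallyCompactSpace H]

theorem twistedConvolution_ne_zero_imp {c : ℝ} {f₁ f₂ : G → ℝ≥0} {g : G}
    (h : twistedConvolution c (fun x => f₁ x) (fun x => f₂ x) g ≠ 0) :
    g ∈ Function.support f₁ * Function.support f₂ := by
  contrapose! h
  rw [twistedConvolution, ← lintegral_zero (μ := (haar : Measure G))]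
  refine lintegral_congr fun x => ?_
  by_contra! hx
  refine h ⟨x, fun h0 => hx (by simp [h0]), x⁻¹ * g, fun h0 => hx (by simp [h0]), by simp⟩

theorem lintegral_coset_le (hH : IsClosed (H : Set G)) {q₁ q₂ q : ℝ}
    (hq₁ : 1 ≤ q₁) (hq₂ : 1 ≤ q₂) (hq : 1 ≤ q) (hqq : 1 / q₁ + 1 / q₂ = 1 + 1 / q) {Y : ℝ≥0∞}
    (hY : ∀ a b : H → ℝ≥0, Continuous a → HasCompactSupport a → Continuous b →
      HasCompactSupport b →
      (∫⁻ h, twistedConvolution (1 - 1 / q₁) (fun x => a x) (fun x => b x) h ^ q ∂haar) ^ (1 / q)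
        ≤ Y * ((∫⁻ h, (a h : ℝ≥0∞) ^ q₁ ∂haar) ^ (1 / q₁)
          * (∫⁻ h, (b h : ℝ≥0∞) ^ q₂ ∂haar) ^ (1 / q₂)))
    {f₁ f₂ : G → ℝ≥0} (hf₁ : Continuous f₁) (hf₁c : HasCompactSupport f₁) (hf₂ : Continuous f₂)
    (hf₂c : HasCompactSupport f₂) {w : G → ℝ≥0} (hw : Continuous w) (hwc : HasCompactSupport w)
    (hw1 : ∀ g ∈ tsupport f₁, ∫⁻ h : H, w ((h : G)⁻¹ * g) ∂haar = 1) (t : G) :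
    ∫⁻ h : H, twistedConvolution (1 - 1 / q₁) (fun x => f₁ x) (fun x => f₂ x) (h * t) ^ q ∂haar
      ≤ (∫⁻ s, Y * ((∫⁻ h : H, (f₁ (h * s) ^ q₁ : ℝ≥0) ∂haar) ^ (1 / q₁)
        * ((∫⁻ h : H, (f₂ (s⁻¹ * h * t) ^ q₂ : ℝ≥0) ∂haar) ^ (1 / q)
          * (∫⁻ h : H, (f₂ (s⁻¹ * h * t) ^ q₂ * (modularCharacter (s⁻¹ * h * t))⁻¹
            * modularCharacter h : ℝ≥0) ∂haar) ^ (1 - 1 / q₁)))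
          ∂(haar.withDensity fun g => (w g : ℝ≥0∞))) ^ q := by
  have hq₁0 : 0 < q₁ := by linarith
  have hq₂0 : 0 < q₂ := by linarith
  have hq0 : 0 < q := by linarith
  have hmG := continuous_modularCharacter (G := G)
  have hmH := continuous_modularCharacter (G := H)
  have hφ : Continuous fun g => f₂ g ^ q₂ * (modularCharacter g)⁻¹ :=
    ((NNReal.continuous_rpow_const hq₂0.le).comp hf₂).mul (hmG.inv₀ modularCharacter_ne_zero)
  set c := 1 - 1 / q₁ with hcdef
  obtain ⟨F, hF, hFeq⟩ := exists_continuous_eq_twistedConvolution c hf₁ hf₁c hf₂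
  set Q : Set G := tsupport f₁ * tsupport f₂
  have hQ : IsCompact Q := hf₁c.isCompact.mul hf₂c.isCompact
  have hFQ : ∀ g, F g ≠ 0 → g ∈ Q := fun g hg =>
    Set.mul_subset_mul (subset_tsupport _) (subset_tsupport _)
      (twistedConvolution_ne_zero_imp (c := c) (by rwa [hFeq, ENNReal.coe_ne_zero]))
  set ν : Measure G := haar.withDensity fun g => (w g : ℝ≥0∞) with hν
  have hνfin : IsFiniteMeasure ν :=
    isFiniteMeasure_withDensity (lintegral_ne_top_of_hasCompactSupport hw hwc haar)
  have hνsupp : ν (tsupport w)ᶜ = 0 := withDensity_compl_tsupport w haar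
  simp_rw [hFeq]
  set k : G → ℝ≥0 := fun g => f₂ g * modularCharacter g ^ (-c)
  have hk : Continuous k := hf₂.mul (continuous_modularCharacter_rpow _)
  obtain ⟨Φ, hΦ, hΦeq⟩ := exists_continuous_eq_lintegral
    (f := fun (z : G × H) (h : H) => f₁ (h * z.1) * k (z.1⁻¹ * (h : G)⁻¹ * z.2 * t))
    (by fun_prop) (fun C hC => ⟨_, IsCompact.preimage_subgroup_coe hH
      (hf₁c.isCompact.mul (hC.image continuous_fst).inv), fun z hz h hne =>
        ⟨_, subset_tsupport _ (left_ne_zero_of_mul hne), _, Set.inv_mem_inv.2 ⟨z, hz, rfl⟩,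
          by simp⟩⟩) (haar : Measure H)
  have hFΦ : ∀ h' : H, (F (h' * t) : ℝ≥0∞) = ∫⁻ s, Φ (s, h') ∂ν := by
    intro h'
    have h1 := lintegral_withDensity_subgroup_eq (H := H) hH hw hwc
      (f := fun g => f₁ g * k (g⁻¹ * (h' * t))) (by fun_prop) hf₁c.mul_right
      fun g hg => hw1 g (subset_tsupport _ (left_ne_zero_of_mul hg))
    rw [← hFeq]
    simp_rw [← hΦeq]
    refine (Eq.trans ?_ h1.symm).trans ?_
    · exact lintegral_congr fun g => by simp [k]
    · simp [mul_assoc, hν]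
  set L : Set H := (↑) ⁻¹' closure (Q * {t⁻¹})
  have hL : IsCompact L :=
    IsCompact.preimage_subgroup_coe hH (hQ.mul isCompact_singleton).closure
  have hLc : IsClosed L := isClosed_closure.preimage continuous_subtype_val
  have hLF : ∀ h : H, F (h * t) ≠ 0 → h ∈ L := fun h hne =>
    subset_closure ⟨_, hFQ _ hne, t⁻¹, rfl, by simp⟩
  have hLfin : IsFiniteMeasure ((haar : Measure H).restrict L) :=
    isFiniteMeasure_restrict.2 hL.measure_lt_top.ne
  rw [← setLIntegral_eq_of_support_subset (s := L) fun h hh => hLF h fun h0 =>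
    hh (by simp [h0, hq0])]
  simp_rw [hFΦ]
  refine lintegral_lintegral_rpow_le (f := fun s h' => (Φ (s, h') : ℝ≥0∞)) ?_ ?_ ?_ hq ?_
  · exact (hΦ.aemeasurable_prod_of_isCompact hwc.isCompact hL hνsupp (by
      rw [restrict_apply hLc.measurableSet.compl]; simp)).coe_nnreal_ennreal
  · exact fun h' => (hΦ.comp
      (by fun_prop : Continuous fun s => (s, h'))).measurable.coe_nnreal_ennreal.aemeasurable
  · have f₂q : Continuous fun g => f₂ g ^ q₂ := (NNReal.continuous_rpow_const hq₂0.le).comp hf₂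
    have f₂qc : HasCompactSupport fun g => f₂ g ^ q₂ :=
      hf₂c.comp_left (g := fun x : ℝ≥0 => x ^ q₂) (NNReal.zero_rpow hq₂0.ne')
    have mA : Measurable fun s => ∫⁻ h : H, (f₁ (h * s) ^ q₁ : ℝ≥0) ∂haar := by
      obtain ⟨v, hv, h⟩ := exists_continuous_eq_lintegral_subgroup (H := H) hH
        ((NNReal.continuous_rpow_const hq₁0.le).comp hf₁)
        (hf₁c.comp_left (g := fun x : ℝ≥0 => x ^ q₁) (NNReal.zero_rpow hq₁0.ne'))
        (continuous_const (y := 1))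
      have h' : ∀ s, ∫⁻ h : H, (f₁ (h * s) ^ q₁ : ℝ≥0) ∂haar = v (1, s) := fun s => by
        simpa using h 1 s
      simp_rw [h']
      exact (hv.comp (Continuous.prodMk_right 1)).measurable.coe_nnreal_ennreal
    have mB : ∀ {f : G → ℝ≥0} {κ : H → ℝ≥0}, Continuous f → HasCompactSupport f → Continuous κ →
        Measurable fun s => ∫⁻ h : H, (f (s⁻¹ * h * t) * κ h : ℝ≥0) ∂haar := by
      intro f κ hf hfc hκ
      obtain ⟨v, hv, h⟩ := exists_continuous_eq_lintegral_subgroup (H := H) hH hf hfc hκ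
      simp_rw [ENNReal.coe_mul, h]
      exact (hv.comp (Continuous.prodMk_left t)).measurable.coe_nnreal_ennreal
    have mB₁ : Measurable fun s => ∫⁻ h : H, (f₂ (s⁻¹ * h * t) ^ q₂ : ℝ≥0) ∂haar := by
      simpa using mB f₂q f₂qc (continuous_const (y := 1))
    exact ((mA.pow_const _).mul ((mB₁.pow_const _).mul
      ((mB hφ f₂qc.mul_right hmH).pow_const _))).const_mul _ |>.aemeasurable
  · refine ae_of_all _ fun s => (setLIntegral_le_lintegral _ _).trans ?_
    have h1 := lintegral_fiber_le hH hq₁ hq₂ hq0 hqq hY hf₁ hf₁c hf₂ hf₂c s t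
    simp_rw [← hΦeq]
    simpa only [k, c, ENNReal.coe_mul] using h1

theorem lintegral_withDensity_inv_mul_le (hH : IsClosed (H : Set G)) {w φ : G → ℝ≥0}
    (hw : Continuous w) (hwc : HasCompactSupport w)
    (hw1 : ∀ g, ∫⁻ h : H, w ((h : G)⁻¹ * g) ∂haar ≤ 1) (hφ : Continuous φ)
    (hφc : HasCompactSupport φ) (t : G) :
    ∫⁻ s, ∫⁻ h : H, (φ (s⁻¹ * h * t) * (modularCharacter (s⁻¹ * h * t))⁻¹
      * modularCharacter h : ℝ≥0) ∂haar ∂(haar.withDensity fun g => (w g : ℝ≥0∞))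
      ≤ ∫⁻ g, φ g ∂haar := by
  set ψ : G → ℝ≥0 := fun g => φ g * (modularCharacter g)⁻¹
  have hψ : Continuous ψ := hφ.mul (continuous_modularCharacter.inv₀ modularCharacter_ne_zero)
  have h1 : ∀ s, ∫⁻ h : H, (φ (s⁻¹ * h * t) * (modularCharacter (s⁻¹ * h * t))⁻¹
      * modularCharacter h : ℝ≥0) ∂haar
      = ∫⁻ h : H, ψ ((h * s : G)⁻¹ * t) ∂haar := by
    intro s
    have hm : Continuous fun h : H => ψ ((h * s : G)⁻¹ * t) := by fun_prop
    rw [← lintegral_haar_inv hm.measurable.coe_nnreal_ennreal]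
    simp [ψ, mul_assoc]
  simp_rw [h1]
  refine (lintegral_withDensity_subgroup_le hH hw hwc hw1 (f := fun g => ψ (g⁻¹ * t))
    (by fun_prop) ?_).trans (le_of_eq ?_)
  swap
  · simpa [ψ] using lintegral_inv_mul_modularCharacter (φ := fun g => (φ g : ℝ≥0∞))
      hφ.measurable.coe_nnreal_ennreal t
  exact HasCompactSupport.comp_homeomorph (f := ψ) hφc.mul_right
    ((Homeomorph.inv G).trans (Homeomorph.mulRight t))

/-- A Young inequality for nonnegative continuous functions with compact support on a closed
subgroup implies the same inequality on the ambient group. -/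
theorem lintegral_twistedConvolution_le_of_subgroup (hH : IsClosed (H : Set G)) {q₁ q₂ q : ℝ}
    (hq₁ : 1 ≤ q₁) (hq₂ : 1 ≤ q₂) (hq : 1 ≤ q) (hqq : 1 / q₁ + 1 / q₂ = 1 + 1 / q) {Y : ℝ≥0∞} (hYtop : Y ≠ ∞)
    (hY : ∀ a b : H → ℝ≥0, Continuous a → HasCompactSupport a → Continuous b →
      HasCompactSupport b →
      (∫⁻ h, twistedConvolution (1 - 1 / q₁) (fun x => a x) (fun x => b x) h ^ q ∂haar) ^ (1 / q)
        ≤ Y * ((∫⁻ h, (a h : ℝ≥0∞) ^ q₁ ∂haar) ^ (1 / q₁)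
          * (∫⁻ h, (b h : ℝ≥0∞) ^ q₂ ∂haar) ^ (1 / q₂)))
    {f₁ f₂ : G → ℝ≥0} (hf₁ : Continuous f₁) (hf₁c : HasCompactSupport f₁) (hf₂ : Continuous f₂)
    (hf₂c : HasCompactSupport f₂) :
    (∫⁻ g, twistedConvolution (1 - 1 / q₁) (fun x => f₁ x) (fun x => f₂ x) g ^ q ∂haar) ^ (1 / q)
      ≤ Y * ((∫⁻ g, (f₁ g : ℝ≥0∞) ^ q₁ ∂haar) ^ (1 / q₁)
        * (∫⁻ g, (f₂ g : ℝ≥0∞) ^ q₂ ∂haar) ^ (1 / q₂)) := by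
  have hq₁0 : 0 < q₁ := by linarith
  have hq₂0 : 0 < q₂ := by linarith
  have hq0 : 0 < q := by linarith
  have hc : 0 ≤ 1 - 1 / q₁ := by
    rw [sub_nonneg, div_le_one (by linarith)]; exact hq₁
  have hmG := continuous_modularCharacter (G := G)
  have hmH := continuous_modularCharacter (G := H)
  set c := 1 - 1 / q₁ with hcdef
  obtain ⟨F, hF, hFeq⟩ := exists_continuous_eq_twistedConvolution c hf₁ hf₁c hf₂
  set Q : Set G := tsupport f₁ * tsupport f₂
  have hQ : IsCompact Q := hf₁c.isCompact.mul hf₂c.isCompact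
  have hFQ : ∀ g, F g ≠ 0 → g ∈ Q := fun g hg =>
    Set.mul_subset_mul (subset_tsupport _) (subset_tsupport _)
      (twistedConvolution_ne_zero_imp (c := c) (by rwa [hFeq, ENNReal.coe_ne_zero]))
  have hFc : HasCompactSupport F :=
    HasCompactSupport.intro' hQ.closure isClosed_closure fun g hg =>
      by_contra fun h => hg (subset_closure (hFQ g h))
  obtain ⟨w, hw, hwc, hw1, hw2⟩ :=
    exists_continuous_lintegral_subgroup_eq_one hH (hf₁c.isCompact.union hQ)
  set ν : Measure G := haar.withDensity fun g => (w g : ℝ≥0∞) with hν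
  have hνfin : IsFiniteMeasure ν :=
    isFiniteMeasure_withDensity (lintegral_ne_top_of_hasCompactSupport hw hwc haar)
  have hνsupp : ν (tsupport w)ᶜ = 0 := withDensity_compl_tsupport w haar
  have hpow : ∀ {f : G → ℝ≥0} {r : ℝ}, 0 < r → Continuous f → HasCompactSupport f →
      Continuous (fun g => f g ^ r) ∧ HasCompactSupport fun g => f g ^ r := fun hr hf hfc =>
    ⟨(NNReal.continuous_rpow_const hr.le).comp hf,
      hfc.comp_left (g := fun x : ℝ≥0 => x ^ _) (NNReal.zero_rpow hr.ne')⟩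
  have hcoe : ∀ (f : G → ℝ≥0) {r : ℝ}, 0 < r → ∫⁻ g, (f g : ℝ≥0∞) ^ r ∂haar
      = ∫⁻ g, (f g ^ r : ℝ≥0) ∂haar := fun f r hr => lintegral_congr fun g =>
    (ENNReal.coe_rpow_of_nonneg _ hr.le).symm
  -- the partial integrals
  obtain ⟨f₁q, f₁qc⟩ := hpow hq₁0 hf₁ hf₁c
  obtain ⟨f₂q, f₂qc⟩ := hpow hq₂0 hf₂ hf₂c
  obtain ⟨Fq, Fqc⟩ := hpow hq0 hF hFc
  have hφ : Continuous fun g => f₂ g ^ q₂ * (modularCharacter g)⁻¹ :=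
    f₂q.mul (hmG.inv₀ modularCharacter_ne_zero)
  obtain ⟨A, hA, hAeq⟩ := exists_continuous_eq_lintegral_subgroup (H := H) hH f₁q f₁qc
    (continuous_const (y := 1))
  obtain ⟨B₁, hB₁, hB₁eq⟩ := exists_continuous_eq_lintegral_subgroup (H := H) hH f₂q f₂qc
    (continuous_const (y := 1))
  obtain ⟨B₂, hB₂, hB₂eq⟩ := exists_continuous_eq_lintegral_subgroup (H := H) hH hφ f₂qc.mul_right
    hmH
  simp only [ENNReal.coe_one, mul_one] at hAeq hB₁eq
  set N₁ := ∫⁻ g, (f₁ g ^ q₁ : ℝ≥0) ∂(haar : Measure G) with hN₁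
  set N₂ := ∫⁻ g, (f₂ g ^ q₂ : ℝ≥0) ∂(haar : Measure G) with hN₂
  have hAle : ∫⁻ s, A (1, s) ∂ν ≤ N₁ := by
    simp_rw [← hAeq, inv_one, one_mul]
    exact lintegral_withDensity_subgroup_le hH hw hwc hw1 f₁q f₁qc
  have hB₁le : ∀ s, ∫⁻ t, B₁ (s, t) ∂ν ≤ N₂ := by
    intro s
    simp_rw [← hB₁eq, mul_assoc]
    refine (lintegral_withDensity_subgroup_le (f := fun g => f₂ (s⁻¹ * g) ^ q₂) hH hw hwc hw1
      (f₂q.comp (continuous_const_mul s⁻¹))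
      (f₂qc.comp_homeomorph (Homeomorph.mulLeft s⁻¹))).trans (le_of_eq ?_)
    exact lintegral_mul_left_eq_self (fun g => ((f₂ g ^ q₂ : ℝ≥0) : ℝ≥0∞)) s⁻¹
  have hB₂le : ∀ t, ∫⁻ s, B₂ (s, t) ∂ν ≤ N₂ := by
    intro t
    simp_rw [← hB₂eq, ← ENNReal.coe_mul]
    exact lintegral_withDensity_inv_mul_le hH hw hwc hw1 f₂q f₂qc t
  have hmeas2 : ∀ {B : G × G → ℝ≥0}, Continuous B → ∀ t, Measurable fun s => (B (s, t) : ℝ≥0∞) :=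
    fun hB t => (hB.comp (by fun_prop : Continuous fun s => (s, t))).measurable.coe_nnreal_ennreal
  have hmeas1 : ∀ {B : G × G → ℝ≥0}, Continuous B → ∀ s, Measurable fun t => (B (s, t) : ℝ≥0∞) :=
    fun hB s => (hB.comp (by fun_prop : Continuous fun t => (s, t))).measurable.coe_nnreal_ennreal
  -- the fibre integrals of the convolution
  have hfiber : ∀ t, ∫⁻ h : H, (F (h * t) : ℝ≥0∞) ^ q ∂haar
      ≤ (∫⁻ s, Y * ((A (1, s) : ℝ≥0∞) ^ (1 / q₁)
        * ((B₁ (s, t) : ℝ≥0∞) ^ (1 / q) * (B₂ (s, t) : ℝ≥0∞) ^ c)) ∂ν) ^ q := by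
    intro t
    have h1 := lintegral_coset_le hH hq₁ hq₂ hq hqq hY hf₁ hf₁c hf₂ hf₂c hw hwc
      (fun g hg => hw2 g (Or.inl hg)) t
    have hA1 : ∀ s, (A (1, s) : ℝ≥0∞) = ∫⁻ h : H, (f₁ (h * s) ^ q₁ : ℝ≥0) ∂haar := fun s => by
      simp [← hAeq]
    simp_rw [hA1, ← hB₁eq, ← hB₂eq]
    simp_rw [← ENNReal.coe_mul]
    simp_rw [← hcdef, hFeq] at h1
    exact h1
  have htotal : ∫⁻ g, (F g : ℝ≥0∞) ^ q ∂haar ≤ Y ^ q * (N₁ ^ (q / q₁) * N₂ ^ (q / q₂)) := by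
    rw [hcoe F hq0, ← lintegral_withDensity_subgroup_eq hH hw hwc Fq Fqc fun g hg =>
      hw2 g (Or.inr (hFQ g fun h0 => hg (by simp [h0, hq0.ne'])))]
    simp_rw [ENNReal.coe_rpow_of_nonneg _ hq0.le]
    calc _ ≤ ∫⁻ t, Y ^ q * (∫⁻ s, (A (1, s) : ℝ≥0∞) ^ (1 / q₁)
          * ((B₁ (s, t) : ℝ≥0∞) ^ (1 / q) * (B₂ (s, t) : ℝ≥0∞) ^ c) ∂ν) ^ q ∂ν := by
          refine lintegral_mono fun t => (hfiber t).trans (le_of_eq ?_)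
          rw [lintegral_const_mul, ENNReal.mul_rpow_of_nonneg _ _ hq0.le]
          exact ((hmeas1 hA 1).pow_const _).mul (((hmeas2 hB₁ t).pow_const _).mul
            ((hmeas2 hB₂ t).pow_const _))
      _ = Y ^ q * ∫⁻ t, (∫⁻ s, (A (1, s) : ℝ≥0∞) ^ (1 / q₁)
          * ((B₁ (s, t) : ℝ≥0∞) ^ (1 / q) * (B₂ (s, t) : ℝ≥0∞) ^ c) ∂ν) ^ q ∂ν := by
          rw [lintegral_const_mul' _ _ (ENNReal.rpow_ne_top_of_nonneg hq0.le hYtop)]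
      _ ≤ _ := by
          gcongr
          exact lintegral_lintegral_mul_rpow_le hq₁ hq₂ hq0 hqq (hmeas1 hA 1).aemeasurable
            (fun t => (hmeas2 hB₁ t).aemeasurable) (fun t => (hmeas2 hB₂ t).aemeasurable)
            (fun s => (hmeas1 hB₁ s).aemeasurable)
            (by
              have hAB : Continuous fun z : G × G => A (1, z.1) * B₁ z := by fun_prop
              simpa [Function.uncurry_def] using
                (hAB.aemeasurable_prod_of_isCompact hwc.isCompact hwc.isCompact hνsupp
                  hνsupp).coe_nnreal_ennreal)
            (lintegral_ne_top_of_hasCompactSupport f₁q f₁qc haar)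
            (lintegral_ne_top_of_hasCompactSupport f₂q f₂qc haar) hAle hB₁le hB₂le
  simp_rw [hFeq]
  rw [hcoe f₁ hq₁0, hcoe f₂ hq₂0, ← hN₁, ← hN₂]
  refine (ENNReal.rpow_le_rpow htotal (by positivity)).trans (le_of_eq ?_)
  rw [ENNReal.mul_rpow_of_nonneg _ _ (by positivity), ENNReal.mul_rpow_of_nonneg _ _ (by positivity),
    ← ENNReal.rpow_mul, ← ENNReal.rpow_mul, ← ENNReal.rpow_mul, mul_one_div_cancel hq0.ne',
    ENNReal.rpow_one]
  congr 3 <;> field_simp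

end Subgroup

/-- In a locally compact regular space, functions in `L^p` with `p < ∞` can be approximated by
continuous functions with compact support. -/
theorem MeasureTheory.MemLp.exists_hasCompactSupport_eLpNorm_sub_le_of_regularSpace {α E : Type*}
    [TopologicalSpace α] [RegularSpace α] [LocallyCompactSpace α] [MeasurableSpace α] [BorelSpace α]
    [NormedAddCommGroup E] [NormedSpace ℝ E] {μ : Measure α} [μ.Regular] {p : ℝ≥0∞} (hp : p ≠ ∞)
    {f : α → E} (hf : MemLp f p μ) {ε : ℝ≥0∞} (hε : ε ≠ 0) :
    ∃ g : α → E, eLpNorm (f - g) p μ ≤ ε ∧ Continuous g ∧ MemLp g p μ ∧ HasCompactSupport g := by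
  apply hf.induction_dense hp _ _ _ _ hε
  rotate_left
  · rintro f g ⟨f_cont, f_mem, hf⟩ ⟨g_cont, g_mem, hg⟩
    exact ⟨f_cont.add g_cont, f_mem.add g_mem, hf.add hg⟩
  · rintro f ⟨_, f_mem, _⟩
    exact f_mem.aestronglyMeasurable
  intro c t ht htμ ε hε
  obtain ⟨δ, δpos, hδ⟩ := exists_Lp_half E μ p hε
  obtain ⟨η, ηpos, hη⟩ := exists_eLpNorm_indicator_le (μ := μ) hp c δpos.ne'
  have hη_pos' : (0 : ℝ≥0∞) < η := ENNReal.coe_pos.2 ηpos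
  obtain ⟨s, st, s_compact, s_closed, μs⟩ :=
    ht.exists_isCompact_isClosed_sdiff_lt htμ.ne hη_pos'.ne'
  have hsμ : μ s < ∞ := (measure_mono st).trans_lt htμ
  have I1 : eLpNorm ((s.indicator fun _y => c) - t.indicator fun _y => c) p μ ≤ δ := by
    rw [← eLpNorm_neg, neg_sub, ← Set.indicator_sdiff st]
    exact hη _ μs.le
  obtain ⟨V, sV, V_open, -, hV⟩ :=
    s_closed.measurableSet.exists_isOpen_sdiff_lt hsμ.ne hη_pos'.ne'
  obtain ⟨g, hg1, hg0, hgc, hg⟩ := exists_continuous_one_zero_of_isCompact s_compact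
    V_open.isClosed_compl (Set.disjoint_compl_right_iff_subset.2 sV)
  have hfc : Continuous fun x => g x • c := by fun_prop
  have hfs : HasCompactSupport fun x => g x • c := hgc.smul_right
  have hfm : MemLp (fun x => g x • c) p μ := hfc.memLp_of_hasCompactSupport hfs
  have I2 : eLpNorm ((fun x => g x • c) - s.indicator fun _ => c) p μ ≤ δ := by
    refine (eLpNorm_mono fun x => ?_).trans (hη (V \ s) hV.le)
    by_cases hs : x ∈ s
    · have : g x = 1 := hg1 hs
      simp [hs, this]
    by_cases hv : x ∈ V
    · simp only [Pi.sub_apply, hs, not_false_iff, Set.indicator_of_notMem, sub_zero,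
        Set.indicator_of_mem (show x ∈ V \ s from ⟨hv, hs⟩), norm_smul, Real.norm_eq_abs,
        abs_of_nonneg (hg x).1]
      exact mul_le_of_le_one_left (norm_nonneg _) (hg x).2
    · have : g x = 0 := hg0 hv
      simp [hs, this]
  refine ⟨fun x => g x • c, ?_, hfc, hfm, hfs⟩
  convert! (hδ _ _
    (hfm.aestronglyMeasurable.sub (aestronglyMeasurable_const.indicator s_closed.measurableSet))
    ((aestronglyMeasurable_const.indicator s_closed.measurableSet).sub
      (aestronglyMeasurable_const.indicator ht)) I2 I1).le using 2
  simp only [sub_add_sub_cancel]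

section Extension

variable {G : Type*} [Group G] [TopologicalSpace G] [IsTopologicalGroup G]
  [LocallyCompactSpace G] [MeasurableSpace G] [BorelSpace G]

theorem ae_haar_inv_mul {P : G → Prop} (h : ∀ᵐ g ∂(haar : Measure G), P g) (t : G) :
    ∀ᵐ g ∂(haar : Measure G), P (g⁻¹ * t) := by
  have h1 : ∀ᵐ g ∂(haar : Measure G), P g⁻¹ := by
    set T := toMeasurable (haar : Measure G) {g | ¬ P g}
    have hT : (haar : Measure G) T = 0 := by rw [measure_toMeasurable]; exact h
    have hTm : MeasurableSet T := measurableSet_toMeasurable _ _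
    have h2 := lintegral_haar_inv (f := T.indicator 1) (measurable_one.indicator hTm)
    have hm : Measurable fun g : G => T.indicator 1 g⁻¹ * (modularCharacter g : ℝ≥0∞) :=
      ((measurable_one.indicator hTm).comp measurable_inv).mul measurable_modularCharacter
    rw [lintegral_indicator_one hTm, hT, lintegral_eq_zero_iff hm] at h2
    filter_upwards [h2] with g hg
    by_contra hP
    have hgT : g⁻¹ ∈ T := subset_toMeasurable _ _ hP
    simp [hgT, modularCharacter_ne_zero] at hg
  have h2 := (eventually_mul_left_iff (haar : Measure G) t⁻¹ (p := fun g => P g⁻¹)).2 h1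
  simpa using h2

theorem MeasureTheory.MemLp.exists_seq_hasCompactSupport {p : ℝ≥0∞}
    (hp1 : 1 ≤ p) (hp : p ≠ ∞)
    {φ : G → ℂ} (hφ : MemLp φ p (haar : Measure G)) :
    ∃ f : ℕ → G → ℝ≥0, (∀ n, Continuous (f n)) ∧ (∀ n, HasCompactSupport (f n)) ∧
      (∀ᵐ g ∂(haar : Measure G), Tendsto (fun n => f n g) atTop (𝓝 ‖φ g‖₊)) ∧
      Tendsto (fun n => (∫⁻ g, (f n g : ℝ≥0∞) ^ p.toReal ∂(haar : Measure G)) ^ (1 / p.toReal))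
        atTop (𝓝 (eLpNorm φ p haar)) := by
  have hp0 : p ≠ 0 := (one_pos.trans_le hp1).ne'
  have hε : ∀ n : ℕ, ((n : ℝ≥0∞) + 1)⁻¹ ≠ 0 := fun n => by simp
  choose ψ hψle hψ hψmem hψc using
    fun n : ℕ => hφ.exists_hasCompactSupport_eLpNorm_sub_le_of_regularSpace hp (hε n)
  have hεlim : Tendsto (fun n : ℕ => ((n : ℝ≥0∞) + 1)⁻¹) atTop (𝓝 0) := by
    have := (ENNReal.tendsto_inv_nat_nhds_zero).comp (tendsto_add_atTop_nat 1)
    simpa [Function.comp_def] using this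
  have hlim : Tendsto (fun n => eLpNorm (ψ n - φ) p haar) atTop (𝓝 0) :=
    tendsto_of_tendsto_of_tendsto_of_le_of_le tendsto_const_nhds hεlim (fun n => bot_le)
      fun n => by rw [eLpNorm_sub_comm]; exact hψle n
  obtain ⟨k, hk, hae⟩ := (tendstoInMeasure_of_tendsto_eLpNorm hp0 (fun n => (hψmem n).1) hφ.1
    hlim).exists_seq_tendsto_ae
  refine ⟨fun n g => ‖ψ (k n) g‖₊, fun n => (hψ _).nnnorm, fun n =>
    (hψc _).comp_left (g := fun z : ℂ => ‖z‖₊) nnnorm_zero, ?_, ?_⟩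
  · filter_upwards [hae] with g hg using hg.nnnorm
  · have h1 : ∀ n, (∫⁻ g, (‖ψ (k n) g‖₊ : ℝ≥0∞) ^ p.toReal ∂(haar : Measure G)) ^ (1 / p.toReal)
        = eLpNorm (ψ (k n)) p haar := fun n => by
      rw [eLpNorm_eq_lintegral_rpow_enorm_toReal hp0 hp]; rfl
    simp_rw [h1]
    have h2 := hlim.comp hk.tendsto_atTop
    refine ENNReal.tendsto_nhds_of_Icc fun ε hε => ?_
    filter_upwards [h2.eventually_le_const hε] with n hn
    simp only [Function.comp_apply] at hn
    constructor
    · rw [tsub_le_iff_right]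
      calc eLpNorm φ p haar = eLpNorm (ψ (k n) - (ψ (k n) - φ)) p haar := by rw [sub_sub_cancel]
        _ ≤ _ := (eLpNorm_sub_le (hψmem _).1 ((hψmem _).1.sub hφ.1) hp1).trans (by gcongr)
    · calc eLpNorm (ψ (k n)) p haar = eLpNorm (φ + (ψ (k n) - φ)) p haar := by
            rw [add_sub_cancel]
        _ ≤ _ := (eLpNorm_add_le hφ.1 ((hψmem _).1.sub hφ.1) hp1).trans (by gcongr)

/-- A Young inequality for nonnegative continuous functions with compact support extends to
measurable functions. -/
theorem lintegral_twistedConvolution_enorm_le {p₁ p₂ : ℝ≥0∞} (hp₁1 : 1 ≤ p₁)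
    (hp₁ : p₁ ≠ ∞) (hp₂1 : 1 ≤ p₂) (hp₂ : p₂ ≠ ∞) {q c : ℝ} (hq : 0 < q)
    {Y : ℝ≥0∞} (hYtop : Y ≠ ∞)
    (hY : ∀ a b : G → ℝ≥0, Continuous a → HasCompactSupport a → Continuous b →
      HasCompactSupport b →
      (∫⁻ h, twistedConvolution c (fun x => a x) (fun x => b x) h ^ q ∂haar) ^ (1 / q)
        ≤ Y * ((∫⁻ h, (a h : ℝ≥0∞) ^ p₁.toReal ∂haar) ^ (1 / p₁.toReal)
          * (∫⁻ h, (b h : ℝ≥0∞) ^ p₂.toReal ∂haar) ^ (1 / p₂.toReal)))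
    {φ₁ φ₂ : G → ℂ} (hφ₁ : MemLp φ₁ p₁ (haar : Measure G)) (hφ₂ : MemLp φ₂ p₂ (haar : Measure G)) :
    (∫⁻ g, twistedConvolution c (fun g => ‖φ₁ g‖ₑ) (fun g => ‖φ₂ g‖ₑ) g ^ q ∂haar) ^ (1 / q)
      ≤ Y * (eLpNorm φ₁ p₁ haar * eLpNorm φ₂ p₂ haar) := by
  obtain ⟨f₁, hf₁, hf₁c, hlim₁, hN₁⟩ := hφ₁.exists_seq_hasCompactSupport hp₁1 hp₁
  obtain ⟨f₂, hf₂, hf₂c, hlim₂, hN₂⟩ := hφ₂.exists_seq_hasCompactSupport hp₂1 hp₂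
  choose F hF hFeq using fun n => exists_continuous_eq_twistedConvolution c (hf₁ n) (hf₁c n) (hf₂ n)
  have hpt : ∀ g', twistedConvolution c (fun g => ‖φ₁ g‖ₑ) (fun g => ‖φ₂ g‖ₑ) g'
      ≤ liminf (fun n => (F n g' : ℝ≥0∞)) atTop := by
    intro g'
    simp_rw [← hFeq, twistedConvolution]
    refine (le_of_eq (lintegral_congr_ae ?_)).trans (lintegral_liminf_le fun n => ?_)
    · filter_upwards [hlim₁, ae_haar_inv_mul hlim₂ g'] with g h1 h2
      have h3 := ENNReal.tendsto_coe.2 (h1.mul (h2.mul_const (modularCharacter (g⁻¹ * g') ^ (-c))))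
      simp only [ENNReal.coe_mul] at h3
      exact h3.liminf_eq.symm
    · have hm := (continuous_modularCharacter_rpow (G := G) (-c)).comp
        (g := fun g : G => modularCharacter g ^ (-c)) (f := fun g : G => g⁻¹ * g') (by fun_prop)
      have : Continuous fun g => f₁ n g * (f₂ n (g⁻¹ * g') * modularCharacter (g⁻¹ * g') ^ (-c)) :=
        (hf₁ n).mul (((hf₂ n).comp (by fun_prop)).mul hm)
      simpa using this.measurable.coe_nnreal_ennreal
  have hbound : ∀ n, ∫⁻ g, (F n g : ℝ≥0∞) ^ q ∂haar
      ≤ (Y * ((∫⁻ h, (f₁ n h : ℝ≥0∞) ^ p₁.toReal ∂haar) ^ (1 / p₁.toReal)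
          * (∫⁻ h, (f₂ n h : ℝ≥0∞) ^ p₂.toReal ∂haar) ^ (1 / p₂.toReal))) ^ q := by
    intro n
    have h := hY _ _ (hf₁ n) (hf₁c n) (hf₂ n) (hf₂c n)
    simp_rw [hFeq] at h
    rwa [one_div q, ENNReal.rpow_inv_le_iff hq] at h
  rw [one_div q, ENNReal.rpow_inv_le_iff hq]
  calc _ ≤ ∫⁻ g, liminf (fun n => (F n g : ℝ≥0∞) ^ q) atTop ∂haar := by
        refine lintegral_mono fun g => (ENNReal.rpow_le_rpow (hpt g) hq.le).trans (le_of_eq ?_)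
        exact (ENNReal.orderIsoRpow q hq).liminf_apply
    _ ≤ liminf (fun n => ∫⁻ g, (F n g : ℝ≥0∞) ^ q ∂haar) atTop :=
        lintegral_liminf_le fun n => (hF n).measurable.coe_nnreal_ennreal.pow_const _
    _ ≤ liminf (fun n => (Y * ((∫⁻ h, (f₁ n h : ℝ≥0∞) ^ p₁.toReal ∂haar) ^ (1 / p₁.toReal)
          * (∫⁻ h, (f₂ n h : ℝ≥0∞) ^ p₂.toReal ∂haar) ^ (1 / p₂.toReal))) ^ q) atTop :=
        liminf_le_liminf (Eventually.of_forall hbound)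
    _ = _ := by
        refine Tendsto.liminf_eq ?_
        refine (ENNReal.continuous_rpow_const.tendsto _).comp ?_
        exact ENNReal.Tendsto.const_mul (ENNReal.Tendsto.mul hN₁ (Or.inr hφ₂.eLpNorm_ne_top) hN₂
          (Or.inr hφ₁.eLpNorm_ne_top)) (Or.inr hYtop)

end Extension

theorem ENNReal.toReal_inv_conjExponent {p : ℝ≥0∞} (hp : 1 ≤ p) :
    ((ENNReal.conjExponent p)⁻¹).toReal = 1 - (p⁻¹).toReal := by
  have h := (ENNReal.HolderConjugate.conjExponent hp).inv_add_inv_eq_one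
  have h1 : p⁻¹ ≠ ∞ := ENNReal.inv_ne_top.2 (one_pos.trans_le hp).ne'
  have h2 : (ENNReal.conjExponent p)⁻¹ ≠ ∞ := ne_top_of_le_ne_top ENNReal.one_ne_top
    (h ▸ le_add_self)
  have h3 := congrArg ENNReal.toReal h
  rw [ENNReal.toReal_add h1 h2, ENNReal.toReal_one] at h3
  linarith

theorem ENNReal.toReal_inv_conjExponent_of_inv_add_inv_eq_one {p₁ p₂ : ℝ≥0∞} (hp₁ : 1 ≤ p₁)
    (hp : p₁⁻¹ + p₂⁻¹ = 1) : ((ENNReal.conjExponent p₁)⁻¹).toReal = (p₂⁻¹).toReal ∧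
      (p₁⁻¹).toReal + (p₂⁻¹).toReal = 1 := by
  have h1 : p₁⁻¹ ≠ ∞ := ne_top_of_le_ne_top ENNReal.one_ne_top (hp ▸ le_self_add)
  have h2 : p₂⁻¹ ≠ ∞ := ne_top_of_le_ne_top ENNReal.one_ne_top (hp ▸ le_add_self)
  have h3 := congrArg ENNReal.toReal hp
  rw [ENNReal.toReal_add h1 h2, ENNReal.toReal_one] at h3
  refine ⟨?_, h3⟩
  rw [ENNReal.toReal_inv_conjExponent hp₁]
  linarith

section Endpoint

variable {G : Type*} [Group G] [TopologicalSpace G] [IsTopologicalGroup G]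
  [LocallyCompactSpace G] [MeasurableSpace G] [BorelSpace G]

/-- Hölder's inequality for the convolution. -/
theorem twistedConvolution_enorm_le {p₁ p₂ : ℝ≥0∞} (hp : p₁⁻¹ + p₂⁻¹ = 1) {φ₁ φ₂ : G → ℂ}
    (hφ₁ : Measurable φ₁) (hφ₂ : Measurable φ₂) (g' : G) :
    twistedConvolution (p₂⁻¹).toReal (fun g => ‖φ₁ g‖ₑ) (fun g => ‖φ₂ g‖ₑ) g'
      ≤ eLpNorm φ₁ p₁ (haar : Measure G) * eLpNorm φ₂ p₂ (haar : Measure G) := by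
  have hconj : ENNReal.HolderTriple p₁ p₂ 1 := ⟨by simpa using hp⟩
  set c := (p₂⁻¹).toReal
  set ξ : G → ℂ := fun g => φ₂ (g⁻¹ * g') *
    (((modularCharacter (g⁻¹ * g') ^ (-c) : ℝ≥0) : ℝ) : ℂ)
  have hm := (continuous_modularCharacter_rpow (G := G) (-c)).comp
    (g := fun g : G => modularCharacter g ^ (-c)) (f := fun g : G => g⁻¹ * g') (by fun_prop)
  have hmul : Measurable fun g : G => g⁻¹ * g' :=
    (by fun_prop : Continuous fun g : G => g⁻¹ * g').measurable
  have hξ : Measurable ξ := (hφ₂.comp hmul).mul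
    (Complex.continuous_ofReal.comp (NNReal.continuous_coe.comp hm)).measurable
  have hξe : ∀ g, ‖ξ g‖ₑ = ‖φ₂ (g⁻¹ * g')‖ₑ * (modularCharacter (g⁻¹ * g') ^ (-c) : ℝ≥0) := by
    intro g
    simp only [ξ, enorm_eq_nnnorm, nnnorm_mul, ENNReal.coe_mul, Complex.nnnorm_real,
      NNReal.nnnorm_eq]
  have h1 := eLpNorm_smul_le_mul_eLpNorm (p := p₁) (q := p₂) (r := 1) (μ := (haar : Measure G))
    hξ.aestronglyMeasurable hφ₁.aestronglyMeasurable
  rw [eLpNorm_one_eq_lintegral_enorm] at h1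
  have h2 : twistedConvolution c (fun g => ‖φ₁ g‖ₑ) (fun g => ‖φ₂ g‖ₑ) g'
      = ∫⁻ g, ‖(φ₁ • ξ) g‖ₑ ∂haar := lintegral_congr fun g => by
    rw [Pi.smul_apply', smul_eq_mul, enorm_mul, hξe]
  rw [h2]
  refine h1.trans ?_
  gcongr
  have hp₂0 : p₂ ≠ 0 := by
    rintro rfl
    simp at hp
  rcases eq_or_ne p₂ ∞ with rfl | hp₂
  · have hc : c = 0 := by simp [c]
    simp only [eLpNorm_exponent_top]
    refine essSup_le_of_ae_le _ ?_
    filter_upwards [ae_haar_inv_mul (ae_le_eLpNormEssSup (f := φ₂) (μ := haar)) g'] with g hg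
    rw [hξe, hc]
    simpa using hg
  · rw [eLpNorm_eq_lintegral_rpow_enorm_toReal hp₂0 hp₂,
      eLpNorm_eq_lintegral_rpow_enorm_toReal hp₂0 hp₂]
    refine ENNReal.rpow_le_rpow (le_of_eq ?_) (by positivity)
    have hp₂pos := ENNReal.toReal_pos hp₂0 hp₂
    rw [← lintegral_inv_mul_modularCharacter (φ := fun g => ‖φ₂ g‖ₑ ^ p₂.toReal) (by fun_prop) g']
    refine lintegral_congr fun g => ?_
    rw [hξe, ENNReal.mul_rpow_of_nonneg _ _ hp₂pos.le, ← ENNReal.coe_rpow_of_nonneg _ hp₂pos.le,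
      ← NNReal.rpow_mul]
    have : -c * p₂.toReal = -1 := by
      simp only [c, ENNReal.toReal_inv]; field_simp
    rw [this, NNReal.rpow_neg_one]

theorem youngConst_le_one_of_inv_add_inv_eq_one {p₁ p₂ : ℝ≥0∞} (hp₁ : 1 ≤ p₁)
    (hp : p₁⁻¹ + p₂⁻¹ = 1) : youngConst p₁ p₂ G ≤ 1 := by
  obtain ⟨hc, -⟩ := ENNReal.toReal_inv_conjExponent_of_inv_add_inv_eq_one hp₁ hp
  refine sSup_le ?_
  rintro _ ⟨φ₁, φ₂, hφ₁, hφ₂, hn₁, hn₂, rfl⟩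
  have : youngExponent p₁ p₂ = ∞ := by simp [youngExponent, hp]
  rw [this, eLpNorm_exponent_top, hc]
  refine essSup_le_of_ae_le _ (ae_of_all _ fun g' => ?_)
  refine (enorm_haarConvolution_le _ φ₁ φ₂ g').trans ?_
  simpa [hn₁, hn₂] using twistedConvolution_enorm_le hp hφ₁ hφ₂ g'

theorem one_le_youngConst_of_inv_add_inv_eq_one {p₁ p₂ : ℝ≥0∞} (hp₁ : 1 ≤ p₁)
    (hp : p₁⁻¹ + p₂⁻¹ = 1) : 1 ≤ youngConst p₁ p₂ G := by
  obtain ⟨hc, hr⟩ := ENNReal.toReal_inv_conjExponent_of_inv_add_inv_eq_one hp₁ hp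
  set r₁ := (p₁⁻¹).toReal with hr₁
  set r₂ := (p₂⁻¹).toReal with hr₂
  have hp₁0 : p₁ ≠ 0 := (one_pos.trans_le hp₁).ne'
  have hp₂0 : p₂ ≠ 0 := by
    rintro rfl
    simp at hp
  have htop : youngExponent p₁ p₂ = ∞ := by simp [youngExponent, hp]
  obtain ⟨K₀, hK₀, hK₀1⟩ := exists_compact_mem_nhds (1 : G)
  set K := closure K₀
  have hK : IsCompact K := hK₀.closure
  have hKc : IsClosed K := isClosed_closure
  have hK1 : K ∈ 𝓝 (1 : G) := mem_of_superset hK₀1 subset_closure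
  have hKi1 : K⁻¹ ∈ 𝓝 (1 : G) := by simpa using inv_mem_nhds_one G hK1
  set μ : Measure G := haar
  obtain ⟨a, ha⟩ : ∃ a : ℝ≥0, μ K = a := ⟨_, (ENNReal.coe_toNNReal hK.measure_lt_top.ne).symm⟩
  have ha0 : a ≠ 0 := by
    rw [← ENNReal.coe_ne_zero, ← ha]
    exact (measure_pos_of_mem_nhds μ hK1).ne'
  have henorm : ∀ x : ℝ≥0, ‖((x : ℝ) : ℂ)‖ₑ = x := fun x => by
    rw [enorm_eq_nnnorm, Complex.nnnorm_real, NNReal.nnnorm_eq]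
  set φ₁ : G → ℂ := K.indicator fun _ => (((a ^ (-r₁) : ℝ≥0) : ℝ) : ℂ)
  set φ₂ : G → ℂ := (K⁻¹).indicator fun g =>
    (((a ^ (-r₂) * modularCharacter g ^ r₂ : ℝ≥0) : ℝ) : ℂ)
  have hn₁ : eLpNorm φ₁ p₁ μ = 1 := by
    have h1 : 1 / p₁.toReal = r₁ := by rw [hr₁, ENNReal.toReal_inv, one_div]
    rw [eLpNorm_indicator_const' hKc.measurableSet (by simp [ha, ha0]) hp₁0, henorm, ha, h1,
      ← ENNReal.coe_rpow_of_ne_zero ha0, ← ENNReal.coe_mul, ← NNReal.rpow_add ha0]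
    simp
  have hn₂ : eLpNorm φ₂ p₂ μ = 1 := by
    rcases eq_or_ne p₂ ∞ with rfl | hp₂
    · have h0 : r₂ = 0 := by simp [hr₂]
      simp only [φ₂, h0, neg_zero, NNReal.rpow_zero, one_mul]
      rw [eLpNorm_indicator_const' hKc.inv.measurableSet (measure_pos_of_mem_nhds μ hKi1).ne' hp₂0]
      simp
    · have hp₂pos := ENNReal.toReal_pos hp₂0 hp₂
      have h1 : r₂ * p₂.toReal = 1 := by rw [hr₂, ENNReal.toReal_inv]; field_simp
      have h2 : ∀ g, ‖φ₂ g‖ₑ ^ p₂.toReal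
          = K.indicator (fun _ => ((a⁻¹ : ℝ≥0) : ℝ≥0∞)) g⁻¹ * modularCharacter g := by
        intro g
        by_cases hg : g ∈ K⁻¹
        · have hg' : g⁻¹ ∈ K := hg
          simp only [φ₂, Set.indicator_of_mem hg, Set.indicator_of_mem hg', henorm]
          rw [← ENNReal.coe_rpow_of_nonneg _ hp₂pos.le, NNReal.mul_rpow, ← NNReal.rpow_mul,
            ← NNReal.rpow_mul, neg_mul, h1, NNReal.rpow_neg_one, NNReal.rpow_one, ENNReal.coe_mul]
        · have hg' : g⁻¹ ∉ K := hg
          simp [φ₂, hg', hp₂pos]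
      rw [eLpNorm_eq_lintegral_rpow_enorm_toReal hp₂0 hp₂]
      simp_rw [h2]
      rw [lintegral_haar_inv (measurable_const.indicator hKc.measurableSet),
        lintegral_indicator_const hKc.measurableSet, ha, ← ENNReal.coe_mul, inv_mul_cancel₀ ha0]
      simp
  have hconv : ∀ g', haarConvolution φ₁ (fun g => φ₂ g * ((modularFunction g ^ r₂ : ℝ) : ℂ)) g'
      = ∫ _ in K ∩ g' • K, (((a⁻¹ : ℝ≥0) : ℝ) : ℂ) ∂μ := by
    intro g'
    rw [← integral_indicator (hKc.measurableSet.inter (hKc.smul g').measurableSet)]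
    refine integral_congr_ae (ae_of_all _ fun g => ?_)
    have hiff : g⁻¹ * g' ∈ K⁻¹ ↔ g ∈ g' • K := by
      rw [Set.mem_smul_set_iff_inv_smul_mem, Set.mem_inv]
      simp
    by_cases h1 : g ∈ K
    · by_cases h2 : g ∈ g' • K
      · have h3 := hiff.2 h2
        simp only [φ₁, φ₂, Set.indicator_of_mem h1, Set.indicator_of_mem h3,
          Set.indicator_of_mem (Set.mem_inter h1 h2), coe_modularFunction_rpow,
          ← Complex.ofReal_mul, ← NNReal.coe_mul]
        rw [mul_assoc (a ^ (-r₂)), ← NNReal.rpow_add (modularCharacter_ne_zero _), add_neg_cancel,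
          NNReal.rpow_zero, mul_one, ← NNReal.rpow_add ha0, ← neg_add, hr, NNReal.rpow_neg_one]
      · have h3 := mt hiff.1 h2
        simp only [φ₂, Set.indicator_of_notMem h3,
          Set.indicator_of_notMem fun h : g ∈ K ∩ g' • K => h2 h.2, zero_mul, mul_zero]
    · simp only [φ₁, Set.indicator_of_notMem h1,
        Set.indicator_of_notMem fun h : g ∈ K ∩ g' • K => h1 h.1, zero_mul]
  have hnorm : ∀ g', ‖haarConvolution φ₁
      (fun g => φ₂ g * ((modularFunction g ^ r₂ : ℝ) : ℂ)) g'‖ₑ = (a - μ (g' • K \ K)) * (a⁻¹ : ℝ≥0) := by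
    intro g'
    have hfin : μ (K ∩ g' • K) ≠ ∞ :=
      ((measure_mono Set.inter_subset_left).trans_lt hK.measure_lt_top).ne
    have hadd : μ (K ∩ g' • K) + μ (g' • K \ K) = a := by
      rw [← ha, ← measure_smul μ g' K, Set.inter_comm, measure_inter_add_sdiff _ hKc.measurableSet]
    rw [hconv, setIntegral_const, enorm_smul, henorm, Real.enorm_of_nonneg measureReal_nonneg,
      measureReal_def, ENNReal.ofReal_toReal hfin, ← hadd, ENNReal.add_sub_cancel_right]
    refine ne_top_of_le_ne_top (ENNReal.coe_ne_top (r := a)) (hadd ▸ le_add_self)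
  have hlim : Tendsto (fun g' => ‖haarConvolution φ₁
      (fun g => φ₂ g * ((modularFunction g ^ r₂ : ℝ) : ℂ)) g'‖ₑ) (𝓝 1) (𝓝 1) := by
    simp_rw [hnorm]
    have h1 := ENNReal.Tendsto.mul_const (b := ((a⁻¹ : ℝ≥0) : ℝ≥0∞)) (ENNReal.Tendsto.sub
      (tendsto_const_nhds (x := (a : ℝ≥0∞)))
      (tendsto_measure_smul_sdiff_isCompact_isClosed (μ := μ) hK hKc)
      (Or.inl ENNReal.coe_ne_top)) (Or.inr ENNReal.coe_ne_top)
    rwa [tsub_zero, ← ENNReal.coe_mul, mul_inv_cancel₀ ha0, ENNReal.coe_one] at h1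
  have hle : eLpNorm (haarConvolution φ₁ fun g => φ₂ g * ((modularFunction g ^ r₂ : ℝ) : ℂ))
      (youngExponent p₁ p₂) μ ≤ youngConst p₁ p₂ G := by
    refine le_sSup ⟨φ₁, φ₂, measurable_const.indicator hKc.measurableSet, ?_, hn₁, hn₂, ?_⟩
    · refine Measurable.indicator ?_ hKc.inv.measurableSet
      exact (Complex.continuous_ofReal.comp (NNReal.continuous_coe.comp
        (continuous_const.mul (continuous_modularCharacter_rpow r₂)))).measurable
    · rw [hc]
  refine le_trans ?_ hle
  rw [htop, eLpNorm_exponent_top]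
  by_contra! hlt
  refine (measure_pos_of_mem_nhds μ (hlim.eventually_const_lt hlt)).ne' ?_
  have hae := ae_le_eLpNormEssSup (μ := μ)
    (f := haarConvolution φ₁ fun g => φ₂ g * ((modularFunction g ^ r₂ : ℝ) : ℂ))
  simpa [ae_iff] using hae

end Endpoint

theorem youngConst_le_youngConst_subgroup {G : Type*} [Group G] [TopologicalSpace G]
    [IsTopologicalGroup G] [LocallyCompactSpace G] [MeasurableSpace G] [BorelSpace G]
    {H : Subgroup G} [LocallyCompactSpace H] (hH : IsClosed (H : Set G)) {p₁ p₂ : ℝ≥0∞}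
    (hp₁ : 1 ≤ p₁) (hp₂ : 1 ≤ p₂) (hp : 1 ≤ p₁⁻¹ + p₂⁻¹) :
    youngConst p₁ p₂ G ≤ youngConst p₁ p₂ H := by
  rcases hp.eq_or_lt with hp1 | hlt
  · exact (youngConst_le_one_of_inv_add_inv_eq_one hp₁ hp1.symm).trans
      (one_le_youngConst_of_inv_add_inv_eq_one hp₁ hp1.symm)
  rcases eq_or_ne (youngConst p₁ p₂ H) ∞ with htop | hYtop
  · rw [htop]; exact le_top
  have hi₁ : p₁⁻¹ ≤ 1 := ENNReal.inv_le_one.2 hp₁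
  have hi₂ : p₂⁻¹ ≤ 1 := ENNReal.inv_le_one.2 hp₂
  have hp₁top : p₁ ≠ ∞ := by
    rintro rfl
    simp only [ENNReal.inv_top, zero_add] at hlt
    exact absurd hlt hi₂.not_gt
  have hp₂top : p₂ ≠ ∞ := by
    rintro rfl
    simp only [ENNReal.inv_top, add_zero] at hlt
    exact absurd hlt hi₁.not_gt
  have hp₁0 : p₁ ≠ 0 := (one_pos.trans_le hp₁).ne'
  have hp₂0 : p₂ ≠ 0 := (one_pos.trans_le hp₂).ne'
  set p := youngExponent p₁ p₂ with hpdef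
  have hpinv : p⁻¹ = p₁⁻¹ + p₂⁻¹ - 1 := by rw [hpdef, youngExponent, inv_inv]
  have hptop : p ≠ ∞ := by
    rw [← ENNReal.inv_ne_zero, hpinv]
    exact (tsub_pos_of_lt hlt).ne'
  have hp1 : 1 ≤ p := by
    rw [← ENNReal.inv_le_one, hpinv, tsub_le_iff_right]
    exact add_le_add hi₁ hi₂
  have hp0 : p ≠ 0 := (one_pos.trans_le hp1).ne'
  have hq : ∀ {r : ℝ≥0∞}, r ≠ ∞ → 1 ≤ r → 1 ≤ r.toReal := fun hr h1 => by
    rw [← ENNReal.toReal_one]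
    exact ENNReal.toReal_mono hr h1
  have hqq : 1 / p₁.toReal + 1 / p₂.toReal = 1 + 1 / p.toReal := by
    have h1 : 1 + p⁻¹ = p₁⁻¹ + p₂⁻¹ := by rw [hpinv, add_tsub_cancel_of_le hp]
    have h2 := congrArg ENNReal.toReal h1
    rw [ENNReal.toReal_add ENNReal.one_ne_top (ENNReal.inv_ne_top.2 hp0),
      ENNReal.toReal_add (ENNReal.inv_ne_top.2 hp₁0) (ENNReal.inv_ne_top.2 hp₂0),
      ENNReal.toReal_one] at h2
    simp only [ENNReal.toReal_inv] at h2
    simp only [one_div]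
    exact h2.symm
  have hc : ((ENNReal.conjExponent p₁)⁻¹).toReal = 1 - 1 / p₁.toReal := by
    rw [ENNReal.toReal_inv_conjExponent hp₁, ENNReal.toReal_inv, one_div]
  have hYH := fun (a b : H → ℝ≥0) (ha : Continuous a) (hac : HasCompactSupport a)
    (hb : Continuous b) (hbc : HasCompactSupport b) =>
      lintegral_twistedConvolution_le hp₁0 hp₁top hp₂0 hp₂top hp0 hptop ha hac hb hbc
  rw [hc] at hYH
  have hYG := fun (a b : G → ℝ≥0) (ha : Continuous a) (hac : HasCompactSupport a)
    (hb : Continuous b) (hbc : HasCompactSupport b) =>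
      lintegral_twistedConvolution_le_of_subgroup hH (hq hp₁top hp₁) (hq hp₂top hp₂)
        (hq hptop hp1) hqq hYtop hYH ha hac hb hbc
  refine sSup_le ?_
  rintro _ ⟨φ₁, φ₂, hφ₁, hφ₂, hn₁, hn₂, rfl⟩
  have hmem₁ : MemLp φ₁ p₁ (haar : Measure G) := ⟨hφ₁.aestronglyMeasurable, by simp [hn₁]⟩
  have hmem₂ : MemLp φ₂ p₂ (haar : Measure G) := ⟨hφ₂.aestronglyMeasurable, by simp [hn₂]⟩
  have h := lintegral_twistedConvolution_enorm_le hp₁ hp₁top hp₂ hp₂top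
    (ENNReal.toReal_pos hp0 hptop) hYtop hYG hmem₁ hmem₂
  rw [hn₁, hn₂, mul_one, mul_one] at h
  rw [← hpdef, eLpNorm_eq_lintegral_rpow_enorm_toReal hp0 hptop, hc]
  refine le_trans ?_ h
  gcongr with g
  exact enorm_haarConvolution_le _ φ₁ φ₂ g

end

theorem theorem1p2 {G : Type*} [Group G] [TopologicalSpace G] [IsTopologicalGroup G]
    [LocallyCompactSpace G] [MeasurableSpace G] [BorelSpace G]
    (H : Subgroup G) (hH : IsClosed (H : Set G))
    (p₁ p₂ : ℝ≥0∞) (hp₁ : 1 ≤ p₁) (hp₂ : 1 ≤ p₂) (hp : 1 ≤ p₁⁻¹ + p₂⁻¹) :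
    haveI : LocallyCompactSpace H := hH.locallyCompactSpace
    youngConst p₁ p₂ G ≤ youngConst p₁ p₂ H := by
  have : LocallyCompactSpace H := hH.locallyCompactSpace
  exact youngConst_le_youngConst_subgroup hH hp₁ hp₂ hp
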